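/- **Conventions.** Quantifier-free Tarski formulas are $\land$-$\lor$-combinations of $\mathrm{true}$, $\mathrm{false}$ and atomic constraints $f\mathrel{\varrho}0$ with $f$ a polynomial expression with integer coefficients and $\varrho\in\{=,\neq,\le,<,\ge,>\}$, interpreted over $\mathbb R$. An *elimination term* $e_i$ for $x_i$ (where $1\le i\le n$) has one of the forms (a) a root expression $\frac{a+b\sqrt c}{d}$ with $a,b,c,d\in\mathbb Z[x_{i+1},\dots,x_n]$, (b) $\infty$, (c) $x_{i+1}-\varepsilon$ (only for $i<n$), with $\varepsilon$ a positive infinitesimal. The *virtual substitution* $\chi[x/\!/e]$ maps quantifier-free formulas to quantifier-free formulas. It replaces each atomic constraint $f\mathrel{\varrho}0$ in $\chi$ as follows. * If $e=\frac{a+b\sqrt c}{d}$, write $f(e)=\frac{g_1+g_2\sqrt c}{g_4}$ with polynomials $g_1,g_2,g_4$ ($g_4$ a product of factors $d$ and $1$), and put $s=g_1^2-g_2^2c$. Then $f=0$ becomes $s=0\land g_1g_2\le0$; $f\neq0$ becomes $s\neq0\lor g_1g_2>0$; $f\le0$ becomes $(g_1g_4\le0\land s\ge0)\lor(g_2g_4\le0\land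 s\le0)$; $f<0$ becomes $(g_1g_4<0\land s>0)\lor(g_2g_4\le0\land(g_1g_4<0\lor s<0))$; $f\ge0$ and $f>0$ become the formulas for $-f\le0$ and $-f<0$. * If $e=\infty$, the constraint becomes the condition on the coefficients of $f$ as a polynomial in $x$, taken from the leading one downwards, that $f\mathrel{\varrho}0$ holds for all sufficiently large $x$; e.g. $\alpha x+\beta<0$ becomes $\alpha<0\lor(\alpha=0\land\beta<0)$. * If $e=t-\varepsilon$ with a variable $t$, the constraint is first replaced using derivatives with respect to $x$, recursively up to a degree bound of $f$ in $x$: $f<0$ by $f<0\lor(f=0\land(f'>0)^\ast)$, $f\le 0$ by $f<0\lor(f=0\land(f'\ge0)^\ast)$, symmetrically for $>,\ge$, $f=0$ by $f=0\land(f'=0)^\ast$, and $f\ne0$ by $f\neq0\lor(f'\neq0)^\ast$, where $(\cdot)^\ast$ denotes the recursive replacement. Then $t$ is substituted for $x$. Let $\varphi=\exists x_n\dots\exists x_1\,\psi(x_1,\dots,x_n)$ be a closed formula with $\psi$ quantifier-free. A scheme $(e_1,\gamma_1),\dots,(e_n,\gamma_n)$ of elimination terms $e_i$ and quantifier-free formulas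 (guards) $\gamma_i(x_{i+1},\dots,x_n)$ is a *pre-EQR* for $\varphi$ (with condition "true") if * whenever $e_i=\frac{a+b\sqrt c}{d}$ is a root expression, $\mathbb R\models\gamma_i\rightarrow(c\ge0\land d\neq0)$, and * the closed quantifier-free formula $\gamma_n\land\bigl(\cdots\land(\gamma_1\land\psi[x_1/\!/e_1])\cdots\bigr)[x_n/\!/e_n]$ is true in $\mathbb R$. **Theorem (Computation of Standard Answers).** There is an algorithm which, given $\psi$ and a pre-EQR $(e_1,\gamma_1),\dots,(e_n,\gamma_n)$ for a closed formula $\varphi=\exists x_n\dots\exists x_1\psi$ with each $e_i$ of one of the forms (a), (b), (c), terminates and outputs root expressions $\widetilde{e_1},\dots,\widetilde{e_n}$ of the form (a) and guards $\widetilde{\gamma_1},\dots,\widetilde{\gamma_n}$ such that $(\widetilde{e_1},\widetilde{\gamma_1}),\dots,(\widetilde{e_n},\widetilde{\gamma_n})$ is a pre-EQR for $\varphi$ as well. Moreover, its standard answers are valid: back-substitution gives real numbers $\alpha_n=\widetilde{e_n}$, $\alpha_{n-1}=\widetilde{e_{n-1}}(\alpha_n)$, …, $\alpha_1=\widetilde{e_1}(\alpha_2,\dots,\alpha_n)$,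 all occurring radicands being nonnegative and all denominators nonzero, and $\mathbb R\models\psi(\alpha_1,\dots,\alpha_n)$. -/

import Mathlib

/-! Quantifier-free Tarski formulas, virtual substitution, and pre-EQRs (one-row extended
quantifier elimination results before back-substitution) for closed existential formulas
`∃ xₙ … ∃ x₁ ψ`.  The variable `xᵢ` is represented by the index `i - 1`, so that `x₁, …, xₙ` are
the variables with indices `0, …, n - 1`. -/

namespace VirtSubst

/-- Terms of the Tarski language: polynomial expressions with integer coefficients. -/
inductive PolyTerm : Type
  | const (z : ℤ)
  | var (i : ℕ)
  | add (f g : PolyTerm)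
  | mul (f g : PolyTerm)
  | neg (f : PolyTerm)

/-- The relation symbols of atomic constraints. -/
inductive Rel : Type
  | eq | ne | le | lt | ge | gt

/-- Quantifier-free Tarski formulas: `∧`-`∨`-combinations of atomic constraints `f ϱ 0`. -/
inductive QF : Type
  | tt
  | ff
  | atom (r : Rel) (f : PolyTerm)
  | and (φ χ : QF)
  | or (φ χ : QF)

/-- A root expression `(a + b√c) / d`. -/
structure RootExpr : Type where
  a : PolyTerm
  b : PolyTerm
  c : PolyTerm
  d : PolyTerm

/-- Elimination terms `eᵢ` for the variable `xᵢ`: a root expression, or `∞`, or `xᵢ₊₁ - ε`. -/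
inductive ElimTerm : Type
  | root (e : RootExpr)
  | infty
  | nextSubEps

/-- A scheme `(e₁, γ₁), …, (eₙ, γₙ)` of elimination terms with substitution guards. -/
abbrev Scheme : Type := List (ElimTerm × QF)

/-- A scheme all of whose elimination terms are root expressions. -/
abbrev StdScheme : Type := List (RootExpr × QF)

/-- A standard scheme, regarded as a scheme. -/
def StdScheme.toScheme (T : StdScheme) : Scheme :=
  T.map fun p => (ElimTerm.root p.1, p.2)

namespace PolyTerm

instance : Add PolyTerm := ⟨add⟩
instance : Mul PolyTerm := ⟨mul⟩
instance : Neg PolyTerm := ⟨neg⟩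
instance : Sub PolyTerm := ⟨fun f g => add f (neg g)⟩
instance : Zero PolyTerm := ⟨const 0⟩
instance : One PolyTerm := ⟨const 1⟩

/-- The interpretation of a term over the reals. -/
def eval (v : ℕ → ℝ) : PolyTerm → ℝ
  | const z => (z : ℝ)
  | var i => v i
  | add f g => f.eval v + g.eval v
  | mul f g => f.eval v * g.eval v
  | neg f => -f.eval v

/-- The variables occurring in a term. -/
def vars : PolyTerm → Finset ℕ
  | const _ => ∅
  | var i => {i}
  | add f g => f.vars ∪ g.vars
  | mul f g => f.vars ∪ g.vars
  | neg f => f.vars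

/-- Regular substitution `f[x / t]`. -/
def subst (f : PolyTerm) (x : ℕ) (t : PolyTerm) : PolyTerm :=
  match f with
  | const z => const z
  | var i => if i = x then t else var i
  | add f g => f.subst x t + g.subst x t
  | mul f g => f.subst x t * g.subst x t
  | neg f => -f.subst x t

/-- The formal partial derivative `∂f/∂x`. -/
def deriv (x : ℕ) : PolyTerm → PolyTerm
  | const _ => 0
  | var i => if i = x then 1 else 0
  | add f g => f.deriv x + g.deriv x
  | mul f g => f.deriv x * g + f * g.deriv x
  | neg f => -f.deriv x

/-- An upper bound for the degree of `f` in `x`. -/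
def degBound (x : ℕ) : PolyTerm → ℕ
  | const _ => 0
  | var i => if i = x then 1 else 0
  | add f g => max (f.degBound x) (g.degBound x)
  | mul f g => f.degBound x + g.degBound x
  | neg f => f.degBound x

/-- The sum of two coefficient lists. -/
def addCoeffs : List PolyTerm → List PolyTerm → List PolyTerm
  | [], l => l
  | l, [] => l
  | a :: l, b :: m => (a + b) :: addCoeffs l m

/-- The product of two coefficient lists. -/
def mulCoeffs : List PolyTerm → List PolyTerm → List PolyTerm
  | [], _ => []
  | a :: l, m => addCoeffs (m.map fun b => a * b) (0 :: mulCoeffs l m)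

/-- The coefficients of `f`, regarded as a polynomial in `x`, with the constant one first. -/
def coeffs (x : ℕ) : PolyTerm → List PolyTerm
  | const z => [const z]
  | var i => if i = x then [0, 1] else [var i]
  | add f g => addCoeffs (f.coeffs x) (g.coeffs x)
  | mul f g => mulCoeffs (f.coeffs x) (g.coeffs x)
  | neg f => (f.coeffs x).map fun a => -a

/-- The root expression `f(e)` with the radicand of `e` that results from plugging the root
expression `e` into `f` for `x`. -/
def atRoot (x : ℕ) (e : RootExpr) : PolyTerm → RootExpr
  | const z => ⟨const z, 0, e.c, 1⟩
  | var i => if i = x then e else ⟨var i, 0, e.c, 1⟩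
  | add f g =>
    let p := f.atRoot x e
    let q := g.atRoot x e
    ⟨p.a * q.d + q.a * p.d, p.b * q.d + q.b * p.d, e.c, p.d * q.d⟩
  | mul f g =>
    let p := f.atRoot x e
    let q := g.atRoot x e
    ⟨p.a * q.a + p.b * q.b * e.c, p.a * q.b + p.b * q.a, e.c, p.d * q.d⟩
  | neg f =>
    let p := f.atRoot x e
    ⟨-p.a, -p.b, e.c, p.d⟩

/-- A Gödel numbering of terms. -/
def code : PolyTerm → ℕ
  | const z => 5 * Encodable.encode z
  | var i => 5 * i + 1
  | add f g => 5 * Nat.pair f.code g.code + 2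
  | mul f g => 5 * Nat.pair f.code g.code + 3
  | neg f => 5 * f.code + 4

theorem code_injective : Function.Injective code := by
  intro f
  induction f with
  | const z =>
    intro g h
    cases g <;> simp only [code] at h
    · congr 1
      exact Encodable.encode_injective (by omega)
    all_goals omega
  | var i =>
    intro g h
    cases g <;> simp only [code] at h
    case var j =>
      congr 1
      omega
    all_goals omega
  | add f₁ f₂ ih₁ ih₂ =>
    intro g h
    cases g <;> simp only [code] at h
    case add g₁ g₂ =>
      have := Nat.pair_eq_pair.1 (show Nat.pair f₁.code f₂.code = Nat.pair g₁.code g₂.code by omega)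
      rw [ih₁ this.1, ih₂ this.2]
    all_goals omega
  | mul f₁ f₂ ih₁ ih₂ =>
    intro g h
    cases g <;> simp only [code] at h
    case mul g₁ g₂ =>
      have := Nat.pair_eq_pair.1 (show Nat.pair f₁.code f₂.code = Nat.pair g₁.code g₂.code by omega)
      rw [ih₁ this.1, ih₂ this.2]
    all_goals omega
  | neg f ih =>
    intro g h
    cases g <;> simp only [code] at h
    case neg g => rw [ih (show f.code = g.code by omega)]
    all_goals omega

theorem code_surjective : Function.Surjective code := by
  intro m
  induction m using Nat.strong_induction_on with
  | _ m ih =>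
    have hl := Nat.unpair_left_le (m / 5)
    have hr := Nat.unpair_right_le (m / 5)
    have hp := Nat.pair_unpair (m / 5)
    obtain h | h | h | h | h :
        m % 5 = 0 ∨ m % 5 = 1 ∨ m % 5 = 2 ∨ m % 5 = 3 ∨ m % 5 = 4 := by omega
    · refine ⟨const (Denumerable.ofNat ℤ (m / 5)), ?_⟩
      simp only [code, Denumerable.encode_ofNat]
      omega
    · exact ⟨var (m / 5), by simp only [code]; omega⟩
    · obtain ⟨f, hf⟩ := ih (m / 5).unpair.1 (by omega)
      obtain ⟨g, hg⟩ := ih (m / 5).unpair.2 (by omega)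
      exact ⟨add f g, by simp only [code, hf, hg, hp]; omega⟩
    · obtain ⟨f, hf⟩ := ih (m / 5).unpair.1 (by omega)
      obtain ⟨g, hg⟩ := ih (m / 5).unpair.2 (by omega)
      exact ⟨mul f g, by simp only [code, hf, hg, hp]; omega⟩
    · obtain ⟨f, hf⟩ := ih (m / 5) (by omega)
      exact ⟨neg f, by simp only [code, hf]; omega⟩

/-- Terms are encoded by their Gödel numbers. -/
noncomputable instance : Denumerable PolyTerm :=
  Denumerable.mk' (Equiv.ofBijective code ⟨code_injective, code_surjective⟩)

end PolyTerm

namespace Rel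

/-- The interpretation of the constraint `s ϱ 0` for a real number `s`. -/
def Holds : Rel → ℝ → Prop
  | eq, s => s = 0
  | ne, s => s ≠ 0
  | le, s => s ≤ 0
  | lt, s => s < 0
  | ge, s => 0 ≤ s
  | gt, s => 0 < s

/-- A numbering of the relation symbols. -/
def code : Rel → ℕ
  | eq => 0
  | ne => 1
  | le => 2
  | lt => 3
  | ge => 4
  | gt => 5

end Rel

namespace RootExpr

/-- The variables occurring in a root expression. -/
def vars (e : RootExpr) : Finset ℕ :=
  e.a.vars ∪ e.b.vars ∪ e.c.vars ∪ e.d.vars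

/-- The root expression is meaningful: its radicand is nonnegative, its denominator nonzero. -/
def Defined (e : RootExpr) (v : ℕ → ℝ) : Prop :=
  0 ≤ e.c.eval v ∧ e.d.eval v ≠ 0

/-- The real value of a root expression (where it is meaningful). -/
noncomputable def value (e : RootExpr) (v : ℕ → ℝ) : ℝ :=
  (e.a.eval v + e.b.eval v * √(e.c.eval v)) / e.d.eval v

/-- Root expressions as quadruples of terms. -/
def equivProd : RootExpr ≃ PolyTerm × PolyTerm × PolyTerm × PolyTerm where
  toFun e := (e.a, e.b, e.c, e.d)
  invFun p := ⟨p.1, p.2.1, p.2.2.1, p.2.2.2⟩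
  left_inv _ := rfl
  right_inv _ := rfl

noncomputable instance : Denumerable RootExpr :=
  Denumerable.ofEquiv _ equivProd

end RootExpr

namespace QF

/-- The interpretation of a quantifier-free formula over the reals. -/
def Holds (v : ℕ → ℝ) : QF → Prop
  | tt => True
  | ff => False
  | atom r f => r.Holds (f.eval v)
  | and φ χ => φ.Holds v ∧ χ.Holds v
  | or φ χ => φ.Holds v ∨ χ.Holds v

/-- The variables occurring in a formula. -/
def vars : QF → Finset ℕ
  | tt => ∅
  | ff => ∅
  | atom _ f => f.vars
  | and φ χ => φ.vars ∪ χ.vars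
  | or φ χ => φ.vars ∪ χ.vars

/-- The extension to all formulas of a substitution that is given on atomic formulas. -/
def mapAtoms (s : Rel → PolyTerm → QF) : QF → QF
  | tt => tt
  | ff => ff
  | atom r f => s r f
  | and φ χ => and (φ.mapAtoms s) (χ.mapAtoms s)
  | or φ χ => or (φ.mapAtoms s) (χ.mapAtoms s)

/-- Regular substitution of a term for a variable in a formula. -/
def subst (x : ℕ) (t : PolyTerm) (φ : QF) : QF :=
  φ.mapAtoms fun r f => atom r (f.subst x t)

/-- A formula in the Tarski language expressing `(a + b√c) / d ϱ 0`, where `c ≥ 0` and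
`d ≠ 0`. -/
def rootAtom (r : Rel) (g : RootExpr) : QF :=
  let s := g.a * g.a - g.b * g.b * g.c
  match r with
  | .eq => and (atom .eq s) (atom .le (g.a * g.b))
  | .ne => or (atom .ne s) (atom .gt (g.a * g.b))
  | .le => or (and (atom .le (g.a * g.d)) (atom .ge s)) (and (atom .le (g.b * g.d)) (atom .le s))
  | .lt => or (and (atom .lt (g.a * g.d)) (atom .gt s))
      (and (atom .le (g.b * g.d)) (or (atom .lt (g.a * g.d)) (atom .lt s)))
  | .ge => or (and (atom .ge (g.a * g.d)) (atom .ge s)) (and (atom .ge (g.b * g.d)) (atom .le s))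
  | .gt => or (and (atom .gt (g.a * g.d)) (atom .gt s))
      (and (atom .ge (g.b * g.d)) (or (atom .gt (g.a * g.d)) (atom .lt s)))

/-- A formula expressing `f ϱ 0` at `∞`, for the polynomial `f` in one variable with the given
coefficients, of which the leading one comes first. -/
def inftyAtom : Rel → List PolyTerm → QF
  | .eq, [] => tt
  | .ne, [] => ff
  | .le, [] => tt
  | .lt, [] => ff
  | .ge, [] => tt
  | .gt, [] => ff
  | .eq, a :: l => and (atom .eq a) (inftyAtom .eq l)
  | .ne, a :: l => or (atom .ne a) (inftyAtom .ne l)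
  | .le, a :: l => or (atom .lt a) (and (atom .eq a) (inftyAtom .le l))
  | .lt, a :: l => or (atom .lt a) (and (atom .eq a) (inftyAtom .lt l))
  | .ge, a :: l => or (atom .gt a) (and (atom .eq a) (inftyAtom .ge l))
  | .gt, a :: l => or (atom .gt a) (and (atom .eq a) (inftyAtom .gt l))

/-- A formula expressing `f ϱ 0` at `x - ε`, for `f` of degree at most `k` in `x`. -/
def epsAtom (x : ℕ) : ℕ → Rel → PolyTerm → QF
  | 0, r, f => atom r f
  | k + 1, .eq, f => and (atom .eq f) (epsAtom x k .eq (f.deriv x))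
  | k + 1, .ne, f => or (atom .ne f) (epsAtom x k .ne (f.deriv x))
  | k + 1, .le, f => or (atom .lt f) (and (atom .eq f) (epsAtom x k .ge (f.deriv x)))
  | k + 1, .lt, f => or (atom .lt f) (and (atom .eq f) (epsAtom x k .gt (f.deriv x)))
  | k + 1, .ge, f => or (atom .gt f) (and (atom .eq f) (epsAtom x k .le (f.deriv x)))
  | k + 1, .gt, f => or (atom .gt f) (and (atom .eq f) (epsAtom x k .lt (f.deriv x)))

/-- The virtual substitution `φ[x // e]`, where `xᵢ₊₁` is the variable with index `x + 1` if
`e` is `xᵢ₊₁ - ε`. -/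
def vsubst (x : ℕ) (e : ElimTerm) (φ : QF) : QF :=
  match e with
  | .root e => φ.mapAtoms fun r f => rootAtom r (f.atRoot x e)
  | .infty => φ.mapAtoms fun r f => inftyAtom r (f.coeffs x).reverse
  | .nextSubEps =>
    (φ.mapAtoms fun r f => epsAtom x (f.degBound x) r f).subst x (PolyTerm.var (x + 1))

/-- A Gödel numbering of quantifier-free formulas. -/
def code : QF → ℕ
  | tt => 0
  | ff => 1
  | atom r f => 3 * (6 * f.code + r.code) + 2
  | and φ χ => 3 * Nat.pair φ.code χ.code + 3
  | or φ χ => 3 * Nat.pair φ.code χ.code + 4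

theorem code_injective : Function.Injective code := by
  intro φ
  induction φ with
  | tt =>
    intro χ h
    cases χ <;> simp only [code] at h
    · rfl
    all_goals omega
  | ff =>
    intro χ h
    cases χ <;> simp only [code] at h
    case ff => rfl
    all_goals omega
  | atom r f =>
    intro χ h
    cases χ <;> simp only [code] at h
    case atom s g =>
      have hr : r.code < 6 := by cases r <;> decide
      have hs : s.code < 6 := by cases s <;> decide
      have h₁ : f = g := PolyTerm.code_injective (by omega)
      have h₂ : r.code = s.code := by omega
      have h₃ : r = s := by
        revert h₂
        cases r <;> cases s <;> simp [Rel.code]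
      rw [h₁, h₃]
    all_goals omega
  | and φ₁ φ₂ ih₁ ih₂ =>
    intro χ h
    cases χ <;> simp only [code] at h
    case and χ₁ χ₂ =>
      have := Nat.pair_eq_pair.1 (show Nat.pair φ₁.code φ₂.code = Nat.pair χ₁.code χ₂.code by omega)
      rw [ih₁ this.1, ih₂ this.2]
    all_goals omega
  | or φ₁ φ₂ ih₁ ih₂ =>
    intro χ h
    cases χ <;> simp only [code] at h
    case or χ₁ χ₂ =>
      have := Nat.pair_eq_pair.1 (show Nat.pair φ₁.code φ₂.code = Nat.pair χ₁.code χ₂.code by omega)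
      rw [ih₁ this.1, ih₂ this.2]
    all_goals omega

theorem code_surjective : Function.Surjective code := by
  intro m
  induction m using Nat.strong_induction_on with
  | _ m ih =>
    have hl := Nat.unpair_left_le ((m - 2) / 3)
    have hr := Nat.unpair_right_le ((m - 2) / 3)
    have hp := Nat.pair_unpair ((m - 2) / 3)
    obtain h | h | ⟨h₂, h⟩ | ⟨h₂, h⟩ | ⟨h₂, h⟩ : m = 0 ∨ m = 1 ∨ (2 ≤ m ∧ (m - 2) % 3 = 0) ∨
        (2 ≤ m ∧ (m - 2) % 3 = 1) ∨ (2 ≤ m ∧ (m - 2) % 3 = 2) := by omega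
    · exact ⟨tt, h.symm⟩
    · exact ⟨ff, h.symm⟩
    · obtain ⟨f, hf⟩ := PolyTerm.code_surjective ((m - 2) / 3 / 6)
      obtain ⟨r, hr⟩ : ∃ r : Rel, r.code = (m - 2) / 3 % 6 := by
        have : (m - 2) / 3 % 6 < 6 := Nat.mod_lt _ (by norm_num)
        interval_cases (m - 2) / 3 % 6
        exacts [⟨.eq, rfl⟩, ⟨.ne, rfl⟩, ⟨.le, rfl⟩, ⟨.lt, rfl⟩, ⟨.ge, rfl⟩, ⟨.gt, rfl⟩]
      exact ⟨atom r f, by simp only [code, hf, hr]; omega⟩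
    · obtain ⟨φ, hφ⟩ := ih ((m - 2) / 3).unpair.1 (by omega)
      obtain ⟨χ, hχ⟩ := ih ((m - 2) / 3).unpair.2 (by omega)
      exact ⟨and φ χ, by simp only [code, hφ, hχ, hp]; omega⟩
    · obtain ⟨φ, hφ⟩ := ih ((m - 2) / 3).unpair.1 (by omega)
      obtain ⟨χ, hχ⟩ := ih ((m - 2) / 3).unpair.2 (by omega)
      exact ⟨or φ χ, by simp only [code, hφ, hχ, hp]; omega⟩

/-- Formulas are encoded by their Gödel numbers. -/
noncomputable instance : Denumerable QF :=
  Denumerable.mk' (Equiv.ofBijective code ⟨code_injective, code_surjective⟩)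

end QF

namespace ElimTerm

/-- Elimination terms as a disjoint union. -/
def equivSum : ElimTerm ≃ Option (Option RootExpr) where
  toFun
    | root e => some (some e)
    | infty => none
    | nextSubEps => some none
  invFun
    | some (some e) => root e
    | none => infty
    | some none => nextSubEps
  left_inv e := by cases e <;> rfl
  right_inv p := by
    rcases p with _ | _ | e <;> rfl

noncomputable instance : Denumerable ElimTerm :=
  Denumerable.ofEquiv _ equivSum

/-- The entry `(e, γ)` for the variable with index `i` among `n` variables is admissible: `e` and
`γ` contain only later variables, and the guard of a root expression makes it meaningful. -/
def Admissible (n i : ℕ) (e : ElimTerm) (γ : QF) : Prop :=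
  γ.vars ⊆ Finset.Ioo i n ∧
    match e with
    | root e => e.vars ⊆ Finset.Ioo i n ∧ ∀ v : ℕ → ℝ, γ.Holds v → e.Defined v
    | infty => True
    | nextSubEps => i + 1 < n

end ElimTerm

/-- The result `γₙ ∧ (… ∧ (γ₁ ∧ ψ[x₁ // e₁]) …)[xₙ // eₙ]` of plugging a scheme into `ψ` by
successive virtual substitution, starting with the variable with index `i`. -/
def Scheme.plugFrom (i : ℕ) (ψ : QF) : Scheme → QF
  | [] => ψ
  | (e, γ) :: S => Scheme.plugFrom (i + 1) (QF.and γ (ψ.vsubst i e)) S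

/-- The scheme `S` is a pre-EQR (with the condition "true") for the closed formula
`∃ xₙ … ∃ x₁ ψ`. -/
def IsPreEQR (n : ℕ) (ψ : QF) (S : Scheme) : Prop :=
  ψ.vars ⊆ Finset.range n ∧ S.length = n ∧
    (∀ (i : ℕ) (hi : i < S.length), ElimTerm.Admissible n i (S[i]).1 (S[i]).2) ∧
    ∀ v : ℕ → ℝ, (Scheme.plugFrom 0 ψ S).Holds v

/-- `α` lists the values of the standard answers after back-substitution; in particular all
root expressions are meaningful there. -/
def StdScheme.IsBackSubst (T : StdScheme) (α : ℕ → ℝ) : Prop :=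
  ∀ (i : ℕ) (hi : i < T.length), (T[i]).1.Defined α ∧ α i = (T[i]).1.value α

end VirtSubst

/-! A true virtual substitution of `∞` or `xᵢ₊₁ - ε` says that the formula holds for all
sufficiently large reals, or for all reals in some interval ending at `xᵢ₊₁` on the right
(`QF.eventually_of_vsubst_infty`, `QF.eventually_of_vsubst_nextSubEps`). Once the later variables
have real values, some natural number `m`, or some `xᵢ₊₁ - 1/(m+1)`, is therefore a genuine witness,
and both are root expressions. For root expressions the substitution is not just sound but exact
wherever the expression is meaningful (`QF.holds_vsubst_root`).

Unwinding the plugged formula from the last variable to the first yields a list `L` of parameters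
and a point `α` that satisfies all guards, the back-substitution equations and `ψ`
(`Scheme.exists_backFrom`). By exactness, `α` also satisfies the plugged formula of the new scheme
(`Scheme.holds_plugFrom_of_backFrom`). Guarded plugging removes the dependence on every variable
(`Scheme.holds_plugFrom_congr`), so truth at one valuation is truth at all, and the new scheme is a
pre-EQR.

The algorithm does not compute suitable parameters; it searches for them. It runs through all lists
of naturals and tests the plugged formula of the resulting standard scheme at the zero valuation,
which takes only integer arithmetic. The list `L` above guarantees termination, and any list that
passes the test yields a pre-EQR. Primitive recursiveness of a single test comes from
course-of-values recursion on Gödel numbers (`PolyTerm.primrec₂_rec`, `QF.primrec₂_rec`). -/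

namespace VirtSubst

open Filter Topology Polynomial

/-! ### Terms as univariate real polynomials, and their coefficient lists -/

namespace PolyTerm

@[simp] theorem eval_add (v : ℕ → ℝ) (f g : PolyTerm) : (f + g).eval v = f.eval v + g.eval v := rfl
@[simp] theorem eval_mul (v : ℕ → ℝ) (f g : PolyTerm) : (f * g).eval v = f.eval v * g.eval v := rfl
@[simp] theorem eval_neg (v : ℕ → ℝ) (f : PolyTerm) : (-f).eval v = -f.eval v := rfl
@[simp] theorem eval_sub (v : ℕ → ℝ) (f g : PolyTerm) : (f - g).eval v = f.eval v - g.eval v :=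
  (sub_eq_add_neg _ _).symm
@[simp] theorem eval_zero (v : ℕ → ℝ) : (0 : PolyTerm).eval v = 0 := Int.cast_zero
@[simp] theorem eval_one (v : ℕ → ℝ) : (1 : PolyTerm).eval v = 1 := Int.cast_one

theorem eval_congr {v w : ℕ → ℝ} {f : PolyTerm} (h : ∀ i ∈ f.vars, v i = w i) :
    f.eval v = f.eval w := by
  induction f with
  | const z => rfl
  | var i => exact h i (by simp [vars])
  | add f g hf hg | mul f g hf hg =>
    simp only [eval]
    rw [hf fun i hi => h i (Finset.mem_union_left _ hi),
      hg fun i hi => h i (Finset.mem_union_right _ hi)]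
  | neg f hf =>
    simp only [eval]
    rw [hf h]

theorem eval_subst (v : ℕ → ℝ) (f : PolyTerm) (x : ℕ) (t : PolyTerm) :
    (f.subst x t).eval v = f.eval (Function.update v x (t.eval v)) := by
  induction f with
  | const z => rfl
  | var i =>
    simp only [subst, eval, Function.update_apply]
    split_ifs <;> rfl
  | add f g hf hg | mul f g hf hg => simp [subst, eval, hf, hg]
  | neg f hf => simp [subst, eval, hf]

/-- The univariate polynomial in `x` obtained by fixing all other variables. -/
noncomputable def poly (v : ℕ → ℝ) (x : ℕ) : PolyTerm → ℝ[X]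
  | const z => C (z : ℝ)
  | var i => if i = x then X else C (v i)
  | add f g => f.poly v x + g.poly v x
  | mul f g => f.poly v x * g.poly v x
  | neg f => -f.poly v x

theorem eval_poly (v : ℕ → ℝ) (x : ℕ) (t : ℝ) (f : PolyTerm) :
    (f.poly v x).eval t = f.eval (Function.update v x t) := by
  induction f with
  | const z => simp [poly, eval]
  | var i =>
    simp only [poly, eval, Function.update_apply]
    split_ifs <;> simp
  | add f g hf hg | mul f g hf hg => simp [poly, eval, hf, hg]
  | neg f hf => simp [poly, eval, hf]

theorem eval_poly_self (v : ℕ → ℝ) (x : ℕ) (f : PolyTerm) :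
    (f.poly v x).eval (v x) = f.eval v := by
  rw [eval_poly, Function.update_eq_self]

theorem natDegree_poly_le (v : ℕ → ℝ) (x : ℕ) (f : PolyTerm) :
    (f.poly v x).natDegree ≤ f.degBound x := by
  induction f with
  | const z => simp [poly]
  | var i =>
    simp only [poly, degBound]
    split_ifs <;> simp
  | add f g hf hg => exact (natDegree_add_le _ _).trans (max_le_max hf hg)
  | mul f g hf hg => exact natDegree_mul_le.trans (add_le_add hf hg)
  | neg f hf => simpa [poly, degBound] using hf

theorem poly_deriv (v : ℕ → ℝ) (x : ℕ) (f : PolyTerm) :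
    (f.deriv x).poly v x = derivative (f.poly v x) := by
  have h0 : (0 : PolyTerm).poly v x = 0 := by simp [poly]
  have h1 : (1 : PolyTerm).poly v x = 1 := by simp [poly]
  have ha (f g : PolyTerm) : (f + g).poly v x = f.poly v x + g.poly v x := rfl
  have hn (f : PolyTerm) : (-f).poly v x = -f.poly v x := rfl
  induction f with
  | const z => simp [deriv, h0, poly]
  | var i =>
    simp only [deriv, poly]
    split_ifs <;> simp [h0, h1]
  | add f g hf hg => simp [deriv, ha, poly, hf, hg]
  | mul f g hf hg => simp [deriv, ha, poly, hf, hg, derivative_mul]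
  | neg f hf => simp [deriv, hn, poly, hf]

/-- The polynomial with the given list of coefficients, the constant one first. -/
noncomputable def ofCoeffs (v : ℕ → ℝ) : List PolyTerm → ℝ[X]
  | [] => 0
  | a :: l => C (a.eval v) + X * ofCoeffs v l

theorem ofCoeffs_addCoeffs (v : ℕ → ℝ) (l m : List PolyTerm) :
    ofCoeffs v (addCoeffs l m) = ofCoeffs v l + ofCoeffs v m := by
  induction l generalizing m with
  | nil => simp [addCoeffs, ofCoeffs]
  | cons a l ih =>
    cases m with
    | nil => simp [addCoeffs, ofCoeffs]
    | cons b m =>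
      simp only [addCoeffs, ofCoeffs, ih, eval_add, C_add]
      ring

theorem ofCoeffs_map_mul (v : ℕ → ℝ) (a : PolyTerm) (l : List PolyTerm) :
    ofCoeffs v (l.map fun b => a * b) = C (a.eval v) * ofCoeffs v l := by
  induction l with
  | nil => simp [ofCoeffs]
  | cons b l ih =>
    simp only [List.map_cons, ofCoeffs, ih, eval_mul, C_mul]
    ring

theorem ofCoeffs_map_neg (v : ℕ → ℝ) (l : List PolyTerm) :
    ofCoeffs v (l.map fun b => -b) = -ofCoeffs v l := by
  induction l with
  | nil => simp [ofCoeffs]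
  | cons b l ih =>
    simp only [List.map_cons, ofCoeffs, ih, eval_neg, C_neg]
    ring

theorem ofCoeffs_mulCoeffs (v : ℕ → ℝ) (l m : List PolyTerm) :
    ofCoeffs v (mulCoeffs l m) = ofCoeffs v l * ofCoeffs v m := by
  induction l with
  | nil => simp [mulCoeffs, ofCoeffs]
  | cons a l ih =>
    simp only [mulCoeffs, ofCoeffs_addCoeffs, ofCoeffs_map_mul, ofCoeffs, ih, eval_zero, C_0]
    ring

theorem ofCoeffs_coeffs (v : ℕ → ℝ) (x : ℕ) (f : PolyTerm) :
    ofCoeffs v (f.coeffs x) = f.poly v x := by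
  induction f with
  | const z => simp [coeffs, ofCoeffs, poly, eval]
  | var i =>
    simp only [coeffs, poly]
    split_ifs <;> simp [ofCoeffs, eval]
  | add f g hf hg => simp [coeffs, ofCoeffs_addCoeffs, poly, hf, hg]
  | mul f g hf hg => simp [coeffs, ofCoeffs_mulCoeffs, poly, hf, hg]
  | neg f hf => simp [coeffs, ofCoeffs_map_neg, poly, hf]

/-- The polynomial with the given list of coefficients, the leading one first. -/
noncomputable def ofCoeffsRev (v : ℕ → ℝ) : List PolyTerm → ℝ[X]
  | [] => 0
  | a :: l => C (a.eval v) * X ^ l.length + ofCoeffsRev v l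

theorem ofCoeffsRev_append (v : ℕ → ℝ) (l : List PolyTerm) (a : PolyTerm) :
    ofCoeffsRev v (l ++ [a]) = X * ofCoeffsRev v l + C (a.eval v) := by
  induction l with
  | nil => simp [ofCoeffsRev]
  | cons b l ih =>
    simp only [List.cons_append, ofCoeffsRev, ih, List.length_append, List.length_singleton]
    ring

theorem ofCoeffsRev_reverse (v : ℕ → ℝ) (l : List PolyTerm) :
    ofCoeffsRev v l.reverse = ofCoeffs v l := by
  induction l with
  | nil => rfl
  | cons a l ih =>
    rw [List.reverse_cons, ofCoeffsRev_append, ih, ofCoeffs]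
    ring

theorem degree_ofCoeffsRev_lt (v : ℕ → ℝ) (l : List PolyTerm) :
    (ofCoeffsRev v l).degree < l.length := by
  induction l with
  | nil => simp [ofCoeffsRev]
  | cons a l ih =>
    have h : ((l.length : ℕ) : WithBot ℕ) < ((a :: l).length : ℕ) := by
      exact_mod_cast Nat.lt_succ_self l.length
    exact (degree_add_le _ _).trans_lt
      (max_lt ((degree_C_mul_X_pow_le _ _).trans_lt h) (ih.trans h))

theorem leadingCoeff_ofCoeffsRev (v : ℕ → ℝ) (a : PolyTerm) (l : List PolyTerm)
    (ha : a.eval v ≠ 0) : (ofCoeffsRev v (a :: l)).leadingCoeff = a.eval v := by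
  rw [ofCoeffsRev, leadingCoeff_add_of_degree_lt', leadingCoeff_C_mul_X_pow]
  rw [degree_C_mul_X_pow _ ha]
  exact degree_ofCoeffsRev_lt v l

end PolyTerm

/-! ### Real polynomials near infinity and to the left of a point -/

theorem eventually_eval_pos {P : ℝ[X]} (h : 0 < P.leadingCoeff) :
    ∀ᶠ t in atTop, 0 < P.eval t := by
  by_cases hd : 0 < P.degree
  · exact (P.tendsto_atTop_of_leadingCoeff_nonneg hd h.le).eventually_gt_atTop 0
  · rw [eq_C_of_degree_le_zero (not_lt.1 hd)] at h ⊢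
    simp_all

theorem eventually_eval_neg {P : ℝ[X]} (h : P.leadingCoeff < 0) :
    ∀ᶠ t in atTop, P.eval t < 0 := by
  have := eventually_eval_pos (P := -P) (by simpa using h)
  simpa using this

/-- Mean value theorem on `[t, a]`: the intermediate point stays in the left neighbourhood where `p`
is known for the derivative. The minus sign is why the constraint on `f'` in `epsAtom` has the
opposite direction. -/
theorem eventually_eq_neg_mul_derivative {P : ℝ[X]} {a : ℝ} (ha : P.eval a = 0) {p : ℝ → Prop}
    (h : ∀ᶠ t in 𝓝[<] a, p ((derivative P).eval t)) :
    ∀ᶠ t in 𝓝[<] a, ∃ s u, 0 < s ∧ p u ∧ P.eval t = -(s * u) := by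
  obtain ⟨b, hb, hbI⟩ := mem_nhdsLT_iff_exists_Ioo_subset.1 h
  filter_upwards [Ioo_mem_nhdsLT hb] with t ht
  obtain ⟨c, hc, hcs⟩ := exists_deriv_eq_slope (fun t => P.eval t) ht.2
    P.continuous.continuousOn P.differentiable.differentiableOn
  have hta : 0 < a - t := sub_pos.2 ht.2
  refine ⟨a - t, (derivative P).eval c, hta, hbI ⟨ht.1.trans hc.1, hc.2⟩, ?_⟩
  rw [Polynomial.deriv, ha, eq_div_iff hta.ne'] at hcs
  linarith

/-! ### Soundness of the substitution of infinity and of infinitesimal shifts -/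

namespace QF

theorem holds_congr {v w : ℕ → ℝ} {φ : QF} (h : ∀ i ∈ φ.vars, v i = w i) :
    φ.Holds v ↔ φ.Holds w := by
  induction φ with
  | tt => rfl
  | ff => rfl
  | atom r f => simp only [Holds]; rw [PolyTerm.eval_congr h]
  | and φ χ hφ hχ | or φ χ hφ hχ =>
    simp only [Holds]
    rw [hφ fun i hi => h i (Finset.mem_union_left _ hi),
      hχ fun i hi => h i (Finset.mem_union_right _ hi)]

theorem holds_mapAtoms_iff {s : Rel → PolyTerm → QF} {v w : ℕ → ℝ}
    (h : ∀ r f, (s r f).Holds v ↔ r.Holds (f.eval w)) (φ : QF) :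
    (φ.mapAtoms s).Holds v ↔ φ.Holds w := by
  induction φ with
  | tt => rfl
  | ff => rfl
  | atom r f => exact h r f
  | and φ χ hφ hχ => exact and_congr hφ hχ
  | or φ χ hφ hχ => exact or_congr hφ hχ

/-- Formulas contain no negation, so one-sided soundness on atoms suffices; finitely many eventual
statements combine. -/
theorem eventually_holds_of_mapAtoms {s : Rel → PolyTerm → QF} {v : ℕ → ℝ} {l : Filter ℝ}
    {w : ℝ → ℕ → ℝ} (h : ∀ r f, (s r f).Holds v → ∀ᶠ t in l, r.Holds (f.eval (w t)))
    {φ : QF} (hφ : (φ.mapAtoms s).Holds v) : ∀ᶠ t in l, φ.Holds (w t) := by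
  induction φ with
  | tt => exact Eventually.of_forall fun _ => trivial
  | ff => exact hφ.elim
  | atom r f => exact h r f hφ
  | and φ χ ih₁ ih₂ => exact (ih₁ hφ.1).and (ih₂ hφ.2)
  | or φ χ ih₁ ih₂ =>
    rcases hφ with hφ | hφ
    exacts [(ih₁ hφ).mono fun _ => Or.inl, (ih₂ hφ).mono fun _ => Or.inr]

theorem holds_subst (x : ℕ) (t : PolyTerm) (φ : QF) (v : ℕ → ℝ) :
    (φ.subst x t).Holds v ↔ φ.Holds (Function.update v x (t.eval v)) :=
  holds_mapAtoms_iff (fun r f => by simp only [Holds]; rw [PolyTerm.eval_subst]) φ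

/-- A nonzero leading coefficient decides the sign near infinity; a vanishing one can be dropped,
which leaves the shorter list. -/
theorem eventually_of_inftyAtom {v : ℕ → ℝ} (r : Rel) (l : List PolyTerm)
    (h : (inftyAtom r l).Holds v) :
    ∀ᶠ t in atTop, r.Holds ((PolyTerm.ofCoeffsRev v l).eval t) := by
  induction l with
  | nil => cases r <;> simp_all [inftyAtom, Holds, Rel.Holds, PolyTerm.ofCoeffsRev]
  | cons a l ih =>
    have hpos : 0 < a.eval v → ∀ᶠ t in atTop, 0 < (PolyTerm.ofCoeffsRev v (a :: l)).eval t :=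
      fun h => eventually_eval_pos (by rwa [PolyTerm.leadingCoeff_ofCoeffsRev _ _ _ h.ne'])
    have hneg : a.eval v < 0 → ∀ᶠ t in atTop, (PolyTerm.ofCoeffsRev v (a :: l)).eval t < 0 :=
      fun h => eventually_eval_neg (by rwa [PolyTerm.leadingCoeff_ofCoeffsRev _ _ _ h.ne])
    have hzero : a.eval v = 0 →
        PolyTerm.ofCoeffsRev v (a :: l) = PolyTerm.ofCoeffsRev v l := by
      intro h
      simp [PolyTerm.ofCoeffsRev, h]
    cases r with
    | eq =>
      rw [hzero h.1]
      exact ih h.2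
    | ne =>
      rcases lt_trichotomy (a.eval v) 0 with ha | ha | ha
      · exact (hneg ha).mono fun _ => ne_of_lt
      · rw [hzero ha]
        exact ih (h.resolve_left (not_not.2 ha))
      · exact (hpos ha).mono fun _ => ne_of_gt
    | le | lt =>
      rcases h with h | h
      · exact (hneg h).mono fun _ ht => by first | exact ht | exact le_of_lt ht
      · rw [hzero h.1]
        exact ih h.2
    | ge | gt =>
      rcases h with h | h
      · exact (hpos h).mono fun _ ht => by first | exact ht | exact le_of_lt ht
      · rw [hzero h.1]
        exact ih h.2

/-- If `f` is nonzero at the point, continuity settles its sign on the left. If it vanishes there,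
the sign comes from the derivative, whose degree is smaller; at bound `0` the polynomial is
constant. -/
theorem eventually_of_epsAtom {v : ℕ → ℝ} {x : ℕ} (k : ℕ) (r : Rel) (f : PolyTerm)
    (hk : (f.poly v x).natDegree ≤ k) (h : (epsAtom x k r f).Holds v) :
    ∀ᶠ t in 𝓝[<] (v x), r.Holds ((f.poly v x).eval t) := by
  induction k generalizing r f with
  | zero =>
    rw [eq_C_of_natDegree_le_zero hk]
    have := f.eval_poly_self v x
    rw [eq_C_of_natDegree_le_zero hk, eval_C] at this
    simp only [eval_C, this]
    exact Eventually.of_forall fun _ => h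
  | succ k ih =>
    have hd (r) (h : (epsAtom x k r (f.deriv x)).Holds v) :
        ∀ᶠ t in 𝓝[<] (v x), r.Holds ((derivative (f.poly v x)).eval t) := by
      have := ih r (f.deriv x)
        (by rw [PolyTerm.poly_deriv]; exact (natDegree_derivative_le _).trans (by omega)) h
      rwa [PolyTerm.poly_deriv] at this
    have hD (r) (h₀ : f.eval v = 0) (h : (epsAtom x k r (f.deriv x)).Holds v) :=
      eventually_eq_neg_mul_derivative ((f.eval_poly_self v x).trans h₀) (hd r h)
    have hcont : Tendsto (fun t => (f.poly v x).eval t) (𝓝[<] (v x)) (𝓝 (f.eval v)) := by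
      rw [← f.eval_poly_self v x]
      exact (f.poly v x).continuous.continuousAt.tendsto.mono_left nhdsWithin_le_nhds
    cases r with
    | eq =>
      filter_upwards [hD _ h.1 h.2] with t ht
      obtain ⟨s, u, hs, hu, e⟩ := ht
      simp only [Rel.Holds] at hu ⊢
      simp [e, hu]
    | ne =>
      by_cases h₀ : f.eval v = 0
      · filter_upwards [hD _ h₀ (h.resolve_left (not_not.2 h₀))] with t ht
        obtain ⟨s, u, hs, hu, e⟩ := ht
        simp only [Rel.Holds] at hu ⊢
        simp [e, hu, hs.ne']
      · exact hcont.eventually_ne h₀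
    | le | lt =>
      rcases h with h | h
      · exact (hcont.eventually_lt_const h).mono fun _ ht => by
          first | exact ht | exact le_of_lt ht
      · filter_upwards [hD _ h.1 h.2] with t ht
        obtain ⟨s, u, hs, hu, e⟩ := ht
        simp only [Rel.Holds] at hu ⊢
        have : 0 ≤ s * u := by positivity
        first | linarith | nlinarith [mul_pos hs hu]
    | ge | gt =>
      rcases h with h | h
      · exact (hcont.eventually_const_lt h).mono fun _ ht => by
          first | exact ht | exact le_of_lt ht
      · filter_upwards [hD _ h.1 h.2] with t ht
        obtain ⟨s, u, hs, hu, e⟩ := ht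
        simp only [Rel.Holds] at hu ⊢
        first
          | linarith [mul_neg_of_pos_of_neg hs hu]
          | linarith [mul_nonpos_of_nonneg_of_nonpos hs.le hu]

end QF

/-! ### Exactness of the substitution of root expressions -/

/-- With `t ≥ 0` the sign of `B * t` is controlled by that of `B`, so the sign of the sum is found
by comparing the absolute values of the two summands, that is, their squares. -/
theorem add_mul_nonpos_iff {A B t : ℝ} (ht : 0 ≤ t) :
    A + B * t ≤ 0 ↔ (A ≤ 0 ∧ 0 ≤ A ^ 2 - (B * t) ^ 2) ∨ (B ≤ 0 ∧ A ^ 2 - (B * t) ^ 2 ≤ 0) := by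
  constructor
  · intro h
    rcases le_or_gt B 0 with hB | hB
    · rcases le_or_gt (A ^ 2 - (B * t) ^ 2) 0 with hs | hs
      · exact .inr ⟨hB, hs⟩
      · have hu : B * t ≤ 0 := mul_nonpos_of_nonpos_of_nonneg hB ht
        refine .inl ⟨?_, hs.le⟩
        by_contra! hA
        nlinarith
    · have hu : 0 ≤ B * t := mul_nonneg hB.le ht
      exact .inl ⟨by linarith, by nlinarith⟩
  · rintro (⟨hA, hs⟩ | ⟨hB, hs⟩)
    · have := sq_le_sq.1 (sub_nonneg.1 hs)
      rw [abs_of_nonpos hA] at this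
      linarith [le_abs_self (B * t)]
    · have := sq_le_sq.1 (sub_nonpos.1 hs)
      rw [abs_of_nonpos (mul_nonpos_of_nonpos_of_nonneg hB ht)] at this
      linarith [le_abs_self A]

theorem add_mul_neg_iff {A B t : ℝ} (ht : 0 ≤ t) :
    A + B * t < 0 ↔ (A < 0 ∧ 0 < A ^ 2 - (B * t) ^ 2) ∨
      (B ≤ 0 ∧ (A < 0 ∨ A ^ 2 - (B * t) ^ 2 < 0)) := by
  constructor
  · intro h
    rcases le_or_gt B 0 with hB | hB
    · have hu : B * t ≤ 0 := mul_nonpos_of_nonpos_of_nonneg hB ht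
      refine .inr ⟨hB, (lt_or_ge A 0).imp_right fun hA => ?_⟩
      nlinarith
    · have hu : 0 ≤ B * t := mul_nonneg hB.le ht
      exact .inl ⟨by linarith, by nlinarith⟩
  · rintro (⟨hA, hs⟩ | ⟨hB, hA | hs⟩)
    · have := sq_lt_sq.1 (sub_pos.1 hs)
      rw [abs_of_neg hA] at this
      linarith [le_abs_self (B * t)]
    · linarith [mul_nonpos_of_nonpos_of_nonneg hB ht]
    · have := sq_lt_sq.1 (sub_neg.1 hs)
      rw [abs_of_nonpos (mul_nonpos_of_nonpos_of_nonneg hB ht)] at this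
      linarith [le_abs_self A]

theorem add_mul_eq_zero_iff {a b t : ℝ} (ht : 0 ≤ t) :
    a + b * t = 0 ↔ a ^ 2 - (b * t) ^ 2 = 0 ∧ a * b ≤ 0 := by
  constructor
  · intro h
    have ha : a = -(b * t) := by linarith
    exact ⟨by rw [ha]; ring, by rw [ha]; nlinarith [mul_nonneg ht (mul_self_nonneg b)]⟩
  · rintro ⟨hs, hab⟩
    rcases sq_eq_sq_iff_eq_or_eq_neg.1 (sub_eq_zero.1 hs) with h | h
    -- Of the two roots `a = ± b * t`, the positive sign is compatible with `a * b ≤ 0` only if both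
    -- summands vanish.
    · have h0 : a * a ≤ 0 := by
        calc a * a = a * b * t := by nth_rw 2 [h]; ring
          _ ≤ 0 := mul_nonpos_of_nonpos_of_nonneg hab ht
      have ha : a = 0 := mul_self_eq_zero.1 (le_antisymm h0 (mul_self_nonneg a))
      rw [← h, ha, add_zero]
    · rw [h]
      ring

/-- Multiplying by `d² > 0` preserves signs and turns the quotient into `ad + bd√c`, to which the
sign criteria apply; the factor `d²` that this brings into `s` is cancelled again. The cases `≥` and
`>` follow by passing to the negative. -/
theorem QF.holds_rootAtom (r : Rel) {g : RootExpr} {v : ℕ → ℝ} (hg : g.Defined v) :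
    (QF.rootAtom r g).Holds v ↔ r.Holds (g.value v) := by
  obtain ⟨hc, hd⟩ := hg
  have ht := Real.sqrt_nonneg (g.c.eval v)
  have htc := Real.sq_sqrt hc
  have hd2 : 0 < g.d.eval v ^ 2 := by positivity
  simp only [RootExpr.value]
  generalize √(g.c.eval v) = t at *
  have hS : (g.a * g.a - g.b * g.b * g.c).eval v = g.a.eval v ^ 2 - (g.b.eval v * t) ^ 2 := by
    simp only [PolyTerm.eval_sub, PolyTerm.eval_mul, ← htc]
    ring
  have hA : (g.a * g.d).eval v = g.a.eval v * g.d.eval v := rfl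
  have hB : (g.b * g.d).eval v = g.b.eval v * g.d.eval v := rfl
  have hC : (g.a * g.b).eval v = g.a.eval v * g.b.eval v := rfl
  have hx : (g.a.eval v + g.b.eval v * t) / g.d.eval v * g.d.eval v ^ 2 =
      g.a.eval v * g.d.eval v + g.b.eval v * g.d.eval v * t := by
    field_simp
  have hx' : (g.a.eval v + g.b.eval v * t) / g.d.eval v * g.d.eval v ^ 2 =
      -(-(g.a.eval v * g.d.eval v) + -(g.b.eval v * g.d.eval v) * t) := by
    rw [hx]
    ring
  have hT : (g.a.eval v * g.d.eval v) ^ 2 - (g.b.eval v * g.d.eval v * t) ^ 2 =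
      (g.a.eval v ^ 2 - (g.b.eval v * t) ^ 2) * g.d.eval v ^ 2 := by
    ring
  have hT' : (-(g.a.eval v * g.d.eval v)) ^ 2 - (-(g.b.eval v * g.d.eval v) * t) ^ 2 =
      (g.a.eval v ^ 2 - (g.b.eval v * t) ^ 2) * g.d.eval v ^ 2 := by
    ring
  have hz : (g.a.eval v + g.b.eval v * t) / g.d.eval v = 0 ↔
      g.a.eval v ^ 2 - (g.b.eval v * t) ^ 2 = 0 ∧ g.a.eval v * g.b.eval v ≤ 0 := by
    rw [div_eq_zero_iff, or_iff_left hd, add_mul_eq_zero_iff ht]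
  have m1 (y : ℝ) : 0 ≤ y * g.d.eval v ^ 2 ↔ 0 ≤ y := mul_nonneg_iff_of_pos_right hd2
  have m2 (y : ℝ) : 0 < y * g.d.eval v ^ 2 ↔ 0 < y := mul_pos_iff_of_pos_right hd2
  have m3 (y : ℝ) : y * g.d.eval v ^ 2 ≤ 0 ↔ y ≤ 0 := by rw [← not_lt, m2, not_lt]
  have m4 (y : ℝ) : y * g.d.eval v ^ 2 < 0 ↔ y < 0 := by rw [← not_le, m1, not_le]
  cases r <;> simp only [rootAtom, Holds, Rel.Holds, hS, hA, hB, hC]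
  · exact hz.symm
  · rw [← not_le, ← not_and_or]
    exact not_congr hz.symm
  · rw [← m3 (_ / _), hx, add_mul_nonpos_iff ht, hT, m1, m3]
  · rw [← m4 (_ / _), hx, add_mul_neg_iff ht, hT, m2, m4]
  · rw [← m1 (_ / _), hx', neg_nonneg, add_mul_nonpos_iff ht, hT', m1, m3, neg_nonpos, neg_nonpos]
  · rw [← m2 (_ / _), hx', neg_pos, add_mul_neg_iff ht, hT', m2, m4, neg_neg_iff_pos, neg_nonpos]

theorem PolyTerm.atRoot_c (x : ℕ) (e : RootExpr) (f : PolyTerm) : (f.atRoot x e).c = e.c := by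
  cases f <;> simp only [atRoot]
  split_ifs <;> rfl

/-- All intermediate results share the radicand `c`, so sums and products stay of the same shape.
Nonnegativity of `c` is needed for `√c * √c = c` in the product. -/
theorem PolyTerm.defined_value_atRoot (x : ℕ) {e : RootExpr} {v : ℕ → ℝ} (he : e.Defined v)
    (f : PolyTerm) : (f.atRoot x e).Defined v ∧
      (f.atRoot x e).value v = f.eval (Function.update v x (e.value v)) := by
  have hc := Real.mul_self_sqrt he.1
  induction f with
  | const z => exact ⟨⟨he.1, by simp [atRoot]⟩, by simp [atRoot, RootExpr.value, eval]⟩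
  | var i =>
    simp only [atRoot, eval, Function.update_apply]
    split_ifs
    · exact ⟨he, rfl⟩
    · exact ⟨⟨he.1, by simp⟩, by simp [RootExpr.value, eval]⟩
  | add f g hf hg =>
    obtain ⟨⟨-, hfd⟩, hf⟩ := hf
    obtain ⟨⟨-, hgd⟩, hg⟩ := hg
    refine ⟨⟨he.1, mul_ne_zero hfd hgd⟩, ?_⟩
    simp only [eval, ← hf, ← hg]
    simp only [RootExpr.value, atRoot, atRoot_c, eval_add, eval_mul]
    field_simp
    ring
  | mul f g hf hg =>
    obtain ⟨⟨-, hfd⟩, hf⟩ := hf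
    obtain ⟨⟨-, hgd⟩, hg⟩ := hg
    refine ⟨⟨he.1, mul_ne_zero hfd hgd⟩, ?_⟩
    simp only [eval, ← hf, ← hg]
    simp only [RootExpr.value, atRoot, atRoot_c, eval_add, eval_mul]
    rw [div_mul_div_comm]
    congr 1
    linear_combination -(eval v (f.atRoot x e).b * eval v (g.atRoot x e).b) * hc
  | neg f hf =>
    obtain ⟨⟨-, hfd⟩, hf⟩ := hf
    refine ⟨⟨he.1, hfd⟩, ?_⟩
    simp only [eval, ← hf]
    simp only [RootExpr.value, atRoot, atRoot_c, eval_neg]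
    ring

theorem QF.holds_vsubst_root (x : ℕ) {e : RootExpr} {v : ℕ → ℝ} (he : e.Defined v) (φ : QF) :
    (φ.vsubst x (.root e)).Holds v ↔ φ.Holds (Function.update v x (e.value v)) :=
  holds_mapAtoms_iff (fun r f => by
    rw [holds_rootAtom r (f.defined_value_atRoot x he).1, (f.defined_value_atRoot x he).2]) φ

theorem QF.eventually_of_vsubst_infty {x : ℕ} {v : ℕ → ℝ} {φ : QF}
    (h : (φ.vsubst x .infty).Holds v) : ∀ᶠ t in atTop, φ.Holds (Function.update v x t) :=
  eventually_holds_of_mapAtoms (fun r f hf => by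
    have := eventually_of_inftyAtom r _ hf
    simpa only [PolyTerm.ofCoeffsRev_reverse, PolyTerm.ofCoeffs_coeffs, PolyTerm.eval_poly]
      using this) h

theorem QF.eventually_of_vsubst_nextSubEps {x : ℕ} {v : ℕ → ℝ} {φ : QF}
    (h : (φ.vsubst x .nextSubEps).Holds v) :
    ∀ᶠ t in 𝓝[<] (v (x + 1)), φ.Holds (Function.update v x t) := by
  -- The final regular substitution moves the base point of the one-sided neighbourhood from the
  -- value of `x` to that of the next variable.
  rw [vsubst, holds_subst] at h
  refine eventually_holds_of_mapAtoms (fun r f hf => ?_) h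
  have := eventually_of_epsAtom _ r f (f.natDegree_poly_le _ x) hf
  simpa only [PolyTerm.eval_poly, Function.update_idem, Function.update_self, PolyTerm.eval]
    using this

/-! ### Replacing virtual terms by root expressions -/

/-- The root expression that replaces an elimination term for the variable with index `i`: the
number `m` for `∞`, and `xᵢ₊₁ - 1 / (m + 1)` for `xᵢ₊₁ - ε`. -/
def ElimTerm.toRoot (i m : ℕ) : ElimTerm → RootExpr
  | root e => e
  | infty => ⟨.const m, 0, 0, 1⟩
  | nextSubEps => ⟨.const (m + 1 : ℕ) * .var (i + 1) - 1, 0, 0, .const (m + 1 : ℕ)⟩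

/-- The replacement of all entries of a scheme by root expressions, with the parameters given by
a list of numbers. -/
def Scheme.toStd : ℕ → Scheme → List ℕ → StdScheme
  | _, [], _ => []
  | i, p :: S, L => (p.1.toRoot i (L.getD 0 0), p.2) :: Scheme.toStd (i + 1) S L.tail

namespace ElimTerm

theorem admissible_toRoot {n i : ℕ} (m : ℕ) {e : ElimTerm} {γ : QF} (h : e.Admissible n i γ) :
    (root (e.toRoot i m)).Admissible n i γ := by
  cases e with
  | root e => exact h
  | infty =>
    refine ⟨h.1, ?_, fun v _ => ⟨?_, ?_⟩⟩
    · exact Finset.empty_subset _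
    · simp [toRoot]
    · simp [toRoot]
  | nextSubEps =>
    refine ⟨h.1, ?_, fun v _ => ⟨?_, ?_⟩⟩
    · have h2 : i + 1 < n := h.2
      intro j hj
      have : j = i + 1 := by
        have h0 : (0 : PolyTerm).vars = ∅ := rfl
        have h1 : (1 : PolyTerm).vars = ∅ := rfl
        have hm (f g : PolyTerm) : (f * g).vars = f.vars ∪ g.vars := rfl
        have hs (f g : PolyTerm) : (f - g).vars = f.vars ∪ g.vars := rfl
        simpa [toRoot, RootExpr.vars, PolyTerm.vars, h0, h1, hm, hs] using hj
      simp [this, h2]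
    · simp [toRoot]
    · simp only [toRoot, PolyTerm.eval, Int.cast_natCast]
      positivity

/-- A virtual substitution that is true can be replaced by the substitution of a suitable root
expression. -/
theorem exists_toRoot {n i : ℕ} {e : ElimTerm} {γ ψ : QF} (h : e.Admissible n i γ) {v : ℕ → ℝ}
    (hv : (QF.and γ (ψ.vsubst i e)).Holds v) :
    ∃ m, ψ.Holds (Function.update v i ((e.toRoot i m).value v)) := by
  cases e with
  | root e => exact ⟨0, (QF.holds_vsubst_root i (h.2.2 v hv.1) ψ).1 hv.2⟩
  | infty =>
    obtain ⟨m, hm⟩ :=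
      (tendsto_natCast_atTop_atTop.eventually (QF.eventually_of_vsubst_infty hv.2)).exists
    exact ⟨m, by simpa [toRoot, RootExpr.value, PolyTerm.eval] using hm⟩
  | nextSubEps =>
    -- The points `xᵢ₊₁ - 1/(m+1)` approach `xᵢ₊₁` strictly from the left, so they eventually enter
    -- the neighbourhood where the formula holds.
    have hlim : Tendsto (fun m : ℕ => v (i + 1) - 1 / ((m : ℝ) + 1)) atTop
        (𝓝[<] (v (i + 1))) := by
      refine tendsto_nhdsWithin_iff.2 ⟨?_, Eventually.of_forall fun m => ?_⟩
      · simpa using (tendsto_const_nhds (x := v (i + 1))).sub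
          (tendsto_one_div_add_atTop_nhds_zero_nat (𝕜 := ℝ))
      · exact sub_lt_self (v (i + 1)) (show 0 < 1 / ((m : ℝ) + 1) by positivity)
    obtain ⟨m, hm⟩ :=
      (hlim.eventually (QF.eventually_of_vsubst_nextSubEps hv.2)).exists
    refine ⟨m, ?_⟩
    convert hm using 2
    have : (m : ℝ) + 1 ≠ 0 := by positivity
    simp [toRoot, RootExpr.value, PolyTerm.eval]
    field_simp

end ElimTerm

/-! ### Back-substitution and independence of the valuation -/

/-- The valuation `α` satisfies all guards of a standard scheme, the first entry of which belongs
to the variable with index `i`, and is obtained from it by back-substitution. -/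
def StdScheme.BackFrom (α : ℕ → ℝ) : ℕ → StdScheme → Prop
  | _, [] => True
  | i, p :: T => p.2.Holds α ∧ p.1.Defined α ∧ α i = p.1.value α ∧ StdScheme.BackFrom α (i + 1) T

/-- All entries of a scheme, the first of which belongs to the variable with index `i`, are
admissible. -/
def Scheme.AdmissibleFrom (n i : ℕ) (S : Scheme) : Prop :=
  ∀ (j : ℕ) (hj : j < S.length), ElimTerm.Admissible n (i + j) (S[j]).1 (S[j]).2

theorem Scheme.admissibleFrom_cons {n i : ℕ} {p : ElimTerm × QF} {S : Scheme} :
    Scheme.AdmissibleFrom n i (p :: S) ↔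
      p.1.Admissible n i p.2 ∧ Scheme.AdmissibleFrom n (i + 1) S := by
  constructor
  · intro h
    refine ⟨h 0 (Nat.succ_pos _), fun j hj => ?_⟩
    have := h (j + 1) (Nat.succ_lt_succ hj)
    rwa [show i + (j + 1) = i + 1 + j by omega] at this
  · rintro ⟨h0, h⟩ j hj
    cases j with
    | zero => exact h0
    | succ j =>
      have := h j (Nat.lt_of_succ_lt_succ hj)
      rwa [show i + 1 + j = i + (j + 1) by omega] at this

theorem StdScheme.BackFrom.isBackSubst {α : ℕ → ℝ} {T : StdScheme} :
    ∀ {i : ℕ}, StdScheme.BackFrom α i T →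
      ∀ (j : ℕ) (hj : j < T.length), (T[j]).1.Defined α ∧ α (i + j) = (T[j]).1.value α := by
  induction T with
  | nil => exact fun _ j hj => absurd hj (Nat.not_lt_zero j)
  | cons p T ih =>
    intro i h j hj
    cases j with
    | zero => exact ⟨h.2.1, h.2.2.1⟩
    | succ j =>
      have := ih h.2.2.2 j (Nat.lt_of_succ_lt_succ hj)
      rwa [show i + 1 + j = i + (j + 1) by omega] at this

theorem RootExpr.eval_congr {e : RootExpr} {v w : ℕ → ℝ} (h : ∀ i ∈ e.vars, v i = w i) :
    e.a.eval v = e.a.eval w ∧ e.b.eval v = e.b.eval w ∧ e.c.eval v = e.c.eval w ∧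
      e.d.eval v = e.d.eval w := by
  refine ⟨?_, ?_, ?_, ?_⟩ <;> refine PolyTerm.eval_congr fun i hi => h i ?_ <;>
    simp [vars, hi]

theorem RootExpr.value_congr {e : RootExpr} {v w : ℕ → ℝ} (h : ∀ i ∈ e.vars, v i = w i) :
    e.value v = e.value w := by
  obtain ⟨ha, hb, hc, hd⟩ := e.eval_congr h
  simp only [value, ha, hb, hc, hd]

theorem RootExpr.defined_congr {e : RootExpr} {v w : ℕ → ℝ} (h : ∀ i ∈ e.vars, v i = w i) :
    e.Defined v ↔ e.Defined w := by
  obtain ⟨-, -, hc, hd⟩ := e.eval_congr h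
  simp only [Defined, hc, hd]

/-- Needed so that assigning a value to an earlier variable leaves the part of the back-substitution
already done intact. -/
theorem StdScheme.BackFrom.congr {n k : ℕ} {T : StdScheme} {α β : ℕ → ℝ}
    (hαβ : ∀ j, k ≤ j → α j = β j) :
    ∀ {i : ℕ}, k ≤ i → Scheme.AdmissibleFrom n i T.toScheme → StdScheme.BackFrom α i T →
      StdScheme.BackFrom β i T := by
  induction T with
  | nil => exact fun _ _ _ => trivial
  | cons p T ih =>
    intro i hk hT h
    obtain ⟨h0, hT⟩ := Scheme.admissibleFrom_cons.1 hT
    have hγ : ∀ j ∈ p.2.vars, α j = β j := fun j hj =>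
      hαβ j (hk.trans (Finset.mem_Ioo.1 (h0.1 hj)).1.le)
    have he : ∀ j ∈ p.1.vars, α j = β j := fun j hj =>
      hαβ j (hk.trans (Finset.mem_Ioo.1 (h0.2.1 hj)).1.le)
    refine ⟨(QF.holds_congr hγ).1 h.1, (RootExpr.defined_congr he).1 h.2.1, ?_,
      ih (hk.trans (Nat.le_succ i)) hT h.2.2.2⟩
    rw [← hαβ i hk, ← RootExpr.value_congr he]
    exact h.2.2.1

namespace Scheme

theorem length_toStd (i : ℕ) (S : Scheme) (L : List ℕ) : (toStd i S L).length = S.length := by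
  induction S generalizing i L with
  | nil => rfl
  | cons p S ih => simp [toStd, ih]

theorem admissibleFrom_toStd {n : ℕ} {S : Scheme} :
    ∀ {i : ℕ} (L : List ℕ), AdmissibleFrom n i S → AdmissibleFrom n i (toStd i S L).toScheme := by
  induction S with
  | nil => exact fun _ h => h
  | cons p S ih =>
    intro i L h
    obtain ⟨h0, h⟩ := admissibleFrom_cons.1 h
    exact admissibleFrom_cons.2 ⟨ElimTerm.admissible_toRoot _ h0, ih L.tail h⟩

theorem toStd_toScheme (i : ℕ) (T : StdScheme) (L : List ℕ) : toStd i T.toScheme L = T := by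
  induction T generalizing i L with
  | nil => rfl
  | cons p T ih => exact congrArg (p :: ·) (ih (i + 1) L.tail)

/-- The induction hypothesis treats the guarded substituted formula as the new matrix and gives
values to the later variables. At this point a single parameter `m` can be chosen for the current
variable, whose coordinate is then overwritten. -/
theorem exists_backFrom {n : ℕ} {S : Scheme} {v : ℕ → ℝ} :
    ∀ {i : ℕ} {ψ : QF}, AdmissibleFrom n i S → (plugFrom i ψ S).Holds v →
      ∃ L α, StdScheme.BackFrom α i (toStd i S L) ∧ ψ.Holds α := by
  induction S with
  | nil => exact fun _ h => ⟨[], v, trivial, h⟩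
  | cons p S ih =>
    intro i ψ hS h
    obtain ⟨h0, hS⟩ := admissibleFrom_cons.1 hS
    obtain ⟨L, α, hα, hψ⟩ := ih hS h
    obtain ⟨m, hm⟩ := p.1.exists_toRoot h0 hψ
    have hR := ElimTerm.admissible_toRoot m h0
    set e := p.1.toRoot i m with he
    have hag : ∀ j, i + 1 ≤ j → α j = Function.update α i (e.value α) j := fun j hj => by
      rw [Function.update_of_ne (by omega)]
    have hev : ∀ j ∈ e.vars, α j = Function.update α i (e.value α) j := fun j hj =>
      hag j (Finset.mem_Ioo.1 (hR.2.1 hj)).1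
    have hγ : p.2.Holds (Function.update α i (e.value α)) :=
      (QF.holds_congr fun j hj => hag j (Finset.mem_Ioo.1 (h0.1 hj)).1).1 hψ.1
    refine ⟨m :: L, Function.update α i (e.value α), ⟨hγ, hR.2.2 _ hγ, ?_, ?_⟩, hm⟩
    · rw [Function.update_self]
      exact RootExpr.value_congr hev
    · exact hα.congr hag le_rfl (admissibleFrom_toStd L hS)

theorem holds_plugFrom_of_backFrom {T : StdScheme} {α : ℕ → ℝ} :
    ∀ {i : ℕ} {ψ : QF}, StdScheme.BackFrom α i T → ψ.Holds α →
      (plugFrom i ψ T.toScheme).Holds α := by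
  induction T with
  | nil => exact fun _ h => h
  | cons p T ih =>
    intro i ψ h hψ
    refine ih h.2.2.2 ⟨h.1, (QF.holds_vsubst_root i h.2.1 ψ).2 ?_⟩
    rwa [← h.2.2.1, Function.update_eq_self]

/-- The dependence of `ψ` on coordinates is stated semantically, so the variables of substituted
formulas need not be tracked. Each step removes one coordinate, and none is left at index `n`. -/
theorem holds_plugFrom_congr {n : ℕ} {T : StdScheme} :
    ∀ {i : ℕ} {ψ : QF}, AdmissibleFrom n i T.toScheme → i + T.length = n →
      (∀ v w : ℕ → ℝ, (∀ j, i ≤ j → j < n → v j = w j) → (ψ.Holds v ↔ ψ.Holds w)) →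
      ∀ v w : ℕ → ℝ, (plugFrom i ψ T.toScheme).Holds v ↔ (plugFrom i ψ T.toScheme).Holds w := by
  induction T with
  | nil =>
    intro i ψ _ hn h v w
    exact h v w fun j hi hj => absurd hj (by simp at hn; omega)
  | cons p T ih =>
    intro i ψ hT hn h
    obtain ⟨h0, hT⟩ := admissibleFrom_cons.1 hT
    refine ih (i := i + 1) hT (by simp at hn; omega) fun v w hvw => ?_
    have hγ : p.2.Holds v ↔ p.2.Holds w := QF.holds_congr fun j hj =>
      hvw j (Finset.mem_Ioo.1 (h0.1 hj)).1 (Finset.mem_Ioo.1 (h0.1 hj)).2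
    have he : p.1.value v = p.1.value w := RootExpr.value_congr fun j hj =>
      hvw j (Finset.mem_Ioo.1 (h0.2.1 hj)).1 (Finset.mem_Ioo.1 (h0.2.1 hj)).2
    -- The guard must be peeled off first: only where it holds is the root expression known to be
    -- meaningful and the virtual substitution exact.
    change _ ∧ _ ↔ _ ∧ _
    rw [← hγ]
    refine and_congr_right fun hg => ?_
    rw [QF.holds_vsubst_root i (h0.2.2 v hg), QF.holds_vsubst_root i (h0.2.2 w (hγ.1 hg)), he]
    refine h _ _ fun j hi hj => ?_
    rcases eq_or_lt_of_le hi with rfl | hi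
    · simp
    · rw [Function.update_of_ne hi.ne', Function.update_of_ne hi.ne']
      exact hvw j hi hj

end Scheme

/-- A scheme without virtual terms that makes the plugged formula true at one valuation is a
pre-EQR, if it arises from a pre-EQR. -/
theorem isPreEQR_toStd {n : ℕ} {ψ : QF} {S : Scheme} (h : IsPreEQR n ψ S) {L : List ℕ}
    {v : ℕ → ℝ} (hv : (Scheme.plugFrom 0 ψ (Scheme.toStd 0 S L).toScheme).Holds v) :
    IsPreEQR n ψ (Scheme.toStd 0 S L).toScheme := by
  obtain ⟨hψ, hlen, hS, -⟩ := h
  have hS' : Scheme.AdmissibleFrom n 0 S := fun j hj => by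
    rw [Nat.zero_add]
    exact hS j hj
  have hT := Scheme.admissibleFrom_toStd L hS'
  refine ⟨hψ, ?_, fun j hj => ?_, fun w => ?_⟩
  · rw [StdScheme.toScheme, List.length_map, Scheme.length_toStd, hlen]
  · have := hT j hj
    rwa [Nat.zero_add] at this
  -- Truth at the single valuation `v` passes to an arbitrary `w`.
  · refine (Scheme.holds_plugFrom_congr hT ?_ (fun v w hvw => ?_) v w).1 hv
    · rw [Nat.zero_add, Scheme.length_toStd, hlen]
    · exact QF.holds_congr fun j hj => hvw j (Nat.zero_le j) (Finset.mem_range.1 (hψ hj))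

theorem IsPreEQR.exists_toStd {n : ℕ} {ψ : QF} {S : Scheme} (h : IsPreEQR n ψ S) :
    ∃ L α, StdScheme.BackFrom α 0 (Scheme.toStd 0 S L) ∧ ψ.Holds α :=
  Scheme.exists_backFrom (v := 0)
    (fun j hj => by
      rw [Nat.zero_add]
      exact h.2.2.1 j hj) (h.2.2.2 0)

theorem IsPreEQR.exists_isBackSubst {n : ℕ} {ψ : QF} {T : StdScheme}
    (h : IsPreEQR n ψ T.toScheme) : ∃ α : ℕ → ℝ, T.IsBackSubst α ∧ ψ.Holds α := by
  obtain ⟨L, α, hα, hψ⟩ := h.exists_toStd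
  -- A standard scheme has no virtual terms to replace, so the parameters `L` have no effect.
  rw [Scheme.toStd_toScheme] at hα
  refine ⟨α, fun i hi => ?_, hψ⟩
  have := hα.isBackSubst i hi
  rwa [Nat.zero_add] at this

theorem IsPreEQR.exists_holds_plugFrom {n : ℕ} {ψ : QF} {S : Scheme} (h : IsPreEQR n ψ S) :
    ∃ L, ∃ v, (Scheme.plugFrom 0 ψ (Scheme.toStd 0 S L).toScheme).Holds v := by
  obtain ⟨L, α, hα, hψ⟩ := h.exists_toStd
  exact ⟨L, α, Scheme.holds_plugFrom_of_backFrom hα hψ⟩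

end VirtSubst

/-! ### Primitive recursive operations on terms and root expressions -/

namespace VirtSubst

namespace PolyTerm

theorem primrec_var : Primrec var :=
  Primrec.encode_iff.1
    (Primrec.succ.comp (Primrec.nat_mul.comp (Primrec.const 5) Primrec.id))

theorem primrec_const_natCast : Primrec fun m : ℕ => const m :=
  Primrec.encode_iff.1
    -- The integer `m ≥ 0` is encoded as `2 * m`, and a constant as five times the code of its
    -- integer.
    (Primrec.nat_mul.comp (Primrec.const 5) (Primrec.nat_mul.comp (Primrec.const 2) Primrec.id))

theorem primrec₂_add : Primrec₂ fun f g : PolyTerm => f + g :=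
  Primrec.encode_iff.1 (Primrec.nat_add.comp (Primrec.nat_mul.comp (Primrec.const 5)
    (Primrec₂.natPair.comp (Primrec.encode.comp Primrec.fst) (Primrec.encode.comp Primrec.snd)))
    (Primrec.const 2))

theorem primrec₂_mul : Primrec₂ fun f g : PolyTerm => f * g :=
  Primrec.encode_iff.1 (Primrec.nat_add.comp (Primrec.nat_mul.comp (Primrec.const 5)
    (Primrec₂.natPair.comp (Primrec.encode.comp Primrec.fst) (Primrec.encode.comp Primrec.snd)))
    (Primrec.const 3))

theorem primrec_neg : Primrec fun f : PolyTerm => -f :=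
  Primrec.encode_iff.1 (Primrec.nat_add.comp (Primrec.nat_mul.comp (Primrec.const 5)
    Primrec.encode) (Primrec.const 4))

theorem primrec₂_sub : Primrec₂ fun f g : PolyTerm => f - g :=
  primrec₂_add.comp₂ Primrec₂.left (primrec_neg.comp₂ Primrec₂.right)

/-- Functions defined by structural recursion on terms are primitive recursive. -/
theorem primrec₂_rec {α σ : Type*} [Primcodable α] [Primcodable σ] {F l : α → PolyTerm → σ}
    {ad ml : α → σ × σ → σ} {ng : α → σ → σ} (hl : Primrec₂ l) (had : Primrec₂ ad)
    (hml : Primrec₂ ml) (hng : Primrec₂ ng)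
    (Hc : ∀ a z, F a (const z) = l a (const z)) (Hv : ∀ a i, F a (var i) = l a (var i))
    (Ha : ∀ a f g, F a (add f g) = ad a (F a f, F a g))
    (Hm : ∀ a f g, F a (mul f g) = ml a (F a f, F a g))
    (Hn : ∀ a f, F a (neg f) = ng a (F a f)) : Primrec₂ F := by
  have hlen : Primrec fun p : α × List σ => p.2.length := Primrec.list_length.comp Primrec.snd
  have hmod : Primrec fun p : α × List σ => p.2.length % 5 :=
    Primrec.nat_mod.comp hlen (Primrec.const 5)
  have hdiv : Primrec fun p : α × List σ => p.2.length / 5 :=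
    Primrec.nat_div.comp hlen (Primrec.const 5)
  have hget {k : α × List σ → ℕ} (hk : Primrec k) : Primrec fun p => p.2[k p]? :=
    Primrec.list_getElem?.comp Primrec.snd hk
  have hun := Primrec.unpair.comp hdiv
  have hbin {b : α → σ × σ → σ} (hb : Primrec₂ b) : Primrec fun p : α × List σ =>
      p.2[(p.2.length / 5).unpair.1]?.bind fun s =>
        p.2[(p.2.length / 5).unpair.2]?.map fun t => b p.1 (s, t) :=
    Primrec.option_bind (hget (Primrec.fst.comp hun))
      (Primrec.option_map ((hget (Primrec.snd.comp hun)).comp Primrec.fst)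
        (hb.comp₂ (Primrec.fst.comp (Primrec.fst.comp Primrec.fst))
          ((Primrec.snd.comp Primrec.fst).pair Primrec.snd)))
  have hcase (k : ℕ) : PrimrecPred fun p : α × List σ => p.2.length % 5 = k :=
    Primrec.eq.comp hmod (Primrec.const k)
  have key : Primrec₂ fun a n => F a (Denumerable.ofNat PolyTerm n) := by
    -- Course-of-values recursion: `L` lists the values at all smaller codes, so `L.length` is the
    -- current code. Its residue mod 5 identifies the constructor, and its quotient gives the codes
    -- of the immediate subterms, at which `L` is read.
    refine Primrec.nat_strong_rec _
      (g := fun a L => if L.length % 5 = 2 then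
          L[(L.length / 5).unpair.1]?.bind fun s =>
            L[(L.length / 5).unpair.2]?.map fun t => ad a (s, t)
        else if L.length % 5 = 3 then
          L[(L.length / 5).unpair.1]?.bind fun s =>
            L[(L.length / 5).unpair.2]?.map fun t => ml a (s, t)
        else if L.length % 5 = 4 then L[L.length / 5]?.map (ng a)
        else some (l a (Denumerable.ofNat PolyTerm L.length))) ?_ ?_
    · exact Primrec.ite (hcase 2) (hbin had) (Primrec.ite (hcase 3) (hbin hml)
        (Primrec.ite (hcase 4)
          (Primrec.option_map (hget hdiv) (hng.comp₂ (Primrec.fst.comp Primrec.fst) Primrec.snd))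
          (Primrec.option_some.comp
            (hl.comp Primrec.fst ((Primrec.ofNat PolyTerm).comp hlen)))))
    · intro a n
      obtain ⟨f, rfl⟩ := code_surjective n
      have hF (f : PolyTerm) : Denumerable.ofNat PolyTerm f.code = f := Denumerable.ofNat_encode f
      have hL (f : PolyTerm) {n : ℕ} (h : f.code < n) :
          ((List.range n).map fun m => F a (Denumerable.ofNat PolyTerm m))[f.code]? =
            some (F a f) := by
        simp [h, hF]
      have hle (f g : PolyTerm) : f.code ≤ Nat.pair f.code g.code ∧
          g.code ≤ Nat.pair f.code g.code := ⟨Nat.left_le_pair _ _, Nat.right_le_pair _ _⟩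
      simp only [List.length_map, List.length_range, hF]
      cases f with
      | const z =>
        have : (const z).code % 5 = 0 := by simp only [code]; omega
        simp [this, Hc]
      | var i =>
        have : (var i).code % 5 = 1 := by simp only [code]; omega
        simp [this, Hv]
      | add f g =>
        have h1 : (add f g).code % 5 = 2 := by simp only [code]; omega
        have h2 : (add f g).code / 5 = Nat.pair f.code g.code := by simp only [code]; omega
        have := hle f g
        rw [if_pos h1, h2, Nat.unpair_pair, hL f (by omega), hL g (by omega)]
        simp [Ha]
      | mul f g =>
        have h1 : (mul f g).code % 5 = 3 := by simp only [code]; omega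
        have h2 : (mul f g).code / 5 = Nat.pair f.code g.code := by simp only [code]; omega
        have := hle f g
        rw [if_neg (by omega), if_pos h1, h2, Nat.unpair_pair, hL f (by omega), hL g (by omega)]
        simp [Hm]
      | neg f =>
        have h1 : (neg f).code % 5 = 4 := by simp only [code]; omega
        have h2 : (neg f).code / 5 = f.code := by simp only [code]; omega
        rw [if_neg (by omega), if_neg (by omega), if_pos h1, h2, hL f (by omega)]
        simp [Hn]
  exact (key.comp₂ Primrec₂.left (Primrec.encode.comp₂ Primrec₂.right)).of_eq fun a f => by simp

end PolyTerm

namespace RootExpr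

theorem primrec_equivProd : Primrec equivProd :=
  Primrec.encode_iff.1 Primrec.encode

theorem primrec_a : Primrec a := Primrec.fst.comp primrec_equivProd
theorem primrec_b : Primrec b := Primrec.fst.comp (Primrec.snd.comp primrec_equivProd)
theorem primrec_c : Primrec c :=
  Primrec.fst.comp (Primrec.snd.comp (Primrec.snd.comp primrec_equivProd))
theorem primrec_d : Primrec d :=
  Primrec.snd.comp (Primrec.snd.comp (Primrec.snd.comp primrec_equivProd))

theorem primrec_mk {α : Type*} [Primcodable α] {a b c d : α → PolyTerm} (ha : Primrec a)
    (hb : Primrec b) (hc : Primrec c) (hd : Primrec d) :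
    Primrec fun x => RootExpr.mk (a x) (b x) (c x) (d x) :=
  Primrec.encode_iff.1 ((Primrec.encode.comp (ha.pair (hb.pair (hc.pair hd)))).of_eq fun _ => rfl)

end RootExpr

theorem PolyTerm.primrec₂_atRoot :
    Primrec₂ fun (p : ℕ × RootExpr) (f : PolyTerm) => f.atRoot p.1 p.2 := by
  open RootExpr in
  have hc : Primrec fun q : (ℕ × RootExpr) × RootExpr × RootExpr => q.1.2.c :=
    primrec_c.comp (Primrec.snd.comp Primrec.fst)
  have h1 : Primrec fun q : (ℕ × RootExpr) × RootExpr × RootExpr => q.2.1 :=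
    Primrec.fst.comp Primrec.snd
  have h2 : Primrec fun q : (ℕ × RootExpr) × RootExpr × RootExpr => q.2.2 :=
    Primrec.snd.comp Primrec.snd
  open RootExpr in
  refine primrec₂_rec
    -- The number `5 * x + 1` is the code of the variable `x`; constants and all other variables
    -- share the second branch.
    (l := fun p f => if f.code = 5 * p.1 + 1 then p.2 else ⟨f, 0, p.2.c, 1⟩)
    (ad := fun p q => ⟨q.1.a * q.2.d + q.2.a * q.1.d, q.1.b * q.2.d + q.2.b * q.1.d, p.2.c,
      q.1.d * q.2.d⟩)
    (ml := fun p q => ⟨q.1.a * q.2.a + q.1.b * q.2.b * p.2.c, q.1.a * q.2.b + q.1.b * q.2.a,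
      p.2.c, q.1.d * q.2.d⟩)
    (ng := fun p q => ⟨-q.a, -q.b, p.2.c, q.d⟩) ?_ ?_ ?_ ?_ ?_ ?_ ?_ ?_ ?_
  · have hf : Primrec fun q : (ℕ × RootExpr) × PolyTerm => q.2.code :=
      Primrec.encode.comp Primrec.snd
    have hx : Primrec fun q : (ℕ × RootExpr) × PolyTerm => 5 * q.1.1 + 1 :=
      Primrec.succ.comp
        (Primrec.nat_mul.comp (Primrec.const 5) (Primrec.fst.comp Primrec.fst))
    have he : Primrec fun q : (ℕ × RootExpr) × PolyTerm => q.1.2 :=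
      Primrec.snd.comp Primrec.fst
    have hm : Primrec fun q : (ℕ × RootExpr) × PolyTerm => RootExpr.mk q.2 0 q.1.2.c 1 :=
      primrec_mk Primrec.snd (Primrec.const 0) (primrec_c.comp he) (Primrec.const 1)
    exact Primrec.ite (Primrec.eq.comp hf hx) he hm
  · exact primrec_mk
      (primrec₂_add.comp (primrec₂_mul.comp (primrec_a.comp h1) (primrec_d.comp h2))
        (primrec₂_mul.comp (primrec_a.comp h2) (primrec_d.comp h1)))
      (primrec₂_add.comp (primrec₂_mul.comp (primrec_b.comp h1) (primrec_d.comp h2))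
        (primrec₂_mul.comp (primrec_b.comp h2) (primrec_d.comp h1)))
      hc (primrec₂_mul.comp (primrec_d.comp h1) (primrec_d.comp h2))
  · exact primrec_mk
      (primrec₂_add.comp (primrec₂_mul.comp (primrec_a.comp h1) (primrec_a.comp h2))
        (primrec₂_mul.comp (primrec₂_mul.comp (primrec_b.comp h1) (primrec_b.comp h2)) hc))
      (primrec₂_add.comp (primrec₂_mul.comp (primrec_a.comp h1) (primrec_b.comp h2))
        (primrec₂_mul.comp (primrec_b.comp h1) (primrec_a.comp h2)))
      hc (primrec₂_mul.comp (primrec_d.comp h1) (primrec_d.comp h2))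
  · exact primrec_mk (primrec_neg.comp (primrec_a.comp Primrec.snd))
      (primrec_neg.comp (primrec_b.comp Primrec.snd))
      (primrec_c.comp (Primrec.snd.comp Primrec.fst)) (primrec_d.comp Primrec.snd)
  · intro p z
    rw [if_neg (by simp only [code]; omega), atRoot]
  · intro p i
    simp [atRoot, code]
  · exact fun _ _ _ => rfl
  · exact fun _ _ _ => rfl
  · exact fun _ _ => rfl

/-! ### Evaluation of terms at zero in natural number arithmetic -/

/-- Natural numbers `p` and `q` such that `p - q` is the value of a term where all variables
vanish. -/
def PolyTerm.posNeg : PolyTerm → ℕ × ℕ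
  | const z => (z.toNat, (-z).toNat)
  | var _ => (0, 0)
  | add f g => (f.posNeg.1 + g.posNeg.1, f.posNeg.2 + g.posNeg.2)
  | mul f g => (f.posNeg.1 * g.posNeg.1 + f.posNeg.2 * g.posNeg.2,
      f.posNeg.1 * g.posNeg.2 + f.posNeg.2 * g.posNeg.1)
  | neg f => (f.posNeg.2, f.posNeg.1)

theorem PolyTerm.eval_eq_posNeg (f : PolyTerm) :
    f.eval 0 = (f.posNeg.1 : ℝ) - f.posNeg.2 := by
  induction f with
  | const z =>
    have hz : (z.toNat : ℤ) - ((-z).toNat : ℤ) = z := by omega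
    simp only [eval, posNeg]
    rw [← Int.cast_natCast z.toNat, ← Int.cast_natCast (-z).toNat, ← Int.cast_sub, hz]
  | var i => simp [eval, posNeg]
  | add f g hf hg | mul f g hf hg =>
    simp only [eval, posNeg, hf, hg, Nat.cast_add, Nat.cast_mul]
    ring
  | neg f hf =>
    simp only [eval, posNeg, hf]
    ring

theorem PolyTerm.primrec_posNeg : Primrec posNeg := by
  have h11 : Primrec fun q : Unit × (ℕ × ℕ) × (ℕ × ℕ) => q.2.1.1 :=
    Primrec.fst.comp (Primrec.fst.comp Primrec.snd)
  have h12 : Primrec fun q : Unit × (ℕ × ℕ) × (ℕ × ℕ) => q.2.1.2 :=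
    Primrec.snd.comp (Primrec.fst.comp Primrec.snd)
  have h21 : Primrec fun q : Unit × (ℕ × ℕ) × (ℕ × ℕ) => q.2.2.1 :=
    Primrec.fst.comp (Primrec.snd.comp Primrec.snd)
  have h22 : Primrec fun q : Unit × (ℕ × ℕ) × (ℕ × ℕ) => q.2.2.2 :=
    Primrec.snd.comp (Primrec.snd.comp Primrec.snd)
  have hcode : Primrec fun q : Unit × PolyTerm => q.2.code := Primrec.encode.comp Primrec.snd
  have h : Primrec₂ fun (_ : Unit) (f : PolyTerm) => f.posNeg := by
    refine primrec₂_rec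
      -- Integers are encoded with `n` as `2 * n` and `-(n + 1)` as `2 * n + 1`; hence the parity
      -- test and the successor in the negative part.
      (l := fun _ f => if f.code % 5 = 0 then
          if f.code / 5 % 2 = 0 then (f.code / 5 / 2, 0) else (0, f.code / 5 / 2 + 1)
        else (0, 0))
      (ad := fun _ q => (q.1.1 + q.2.1, q.1.2 + q.2.2))
      (ml := fun _ q => (q.1.1 * q.2.1 + q.1.2 * q.2.2, q.1.1 * q.2.2 + q.1.2 * q.2.1))
      (ng := fun _ q => (q.2, q.1)) ?_ ?_ ?_ ?_ ?_ ?_ ?_ ?_ ?_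
    · have hdiv := Primrec.nat_div.comp hcode (Primrec.const 5)
      have hdiv2 := Primrec.nat_div.comp hdiv (Primrec.const 2)
      exact Primrec.ite
        (Primrec.eq.comp (Primrec.nat_mod.comp hcode (Primrec.const 5)) (Primrec.const 0))
        (Primrec.ite
          (Primrec.eq.comp (Primrec.nat_mod.comp hdiv (Primrec.const 2)) (Primrec.const 0))
          (hdiv2.pair (Primrec.const 0)) ((Primrec.const 0).pair (Primrec.succ.comp hdiv2)))
        (Primrec.const (0, 0))
    · exact (Primrec.nat_add.comp h11 h21).pair (Primrec.nat_add.comp h12 h22)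
    · exact (Primrec.nat_add.comp (Primrec.nat_mul.comp h11 h21)
        (Primrec.nat_mul.comp h12 h22)).pair
        (Primrec.nat_add.comp (Primrec.nat_mul.comp h11 h22) (Primrec.nat_mul.comp h12 h21))
    · exact (Primrec.snd.comp Primrec.snd).pair (Primrec.fst.comp Primrec.snd)
    · intro _ z
      have h0 : (const z).code % 5 = 0 := by simp only [code]; omega
      have h1 : (const z).code / 5 = Encodable.encode z := by simp only [code]; omega
      rw [if_pos h0, h1]
      obtain n | n := z
      · have : Encodable.encode (Int.ofNat n) = 2 * n := rfl
        rw [this, if_pos (by omega), posNeg]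
        refine Prod.ext ?_ ?_
        · simp
        · simp
      · have : Encodable.encode (Int.negSucc n) = 2 * n + 1 := rfl
        rw [this, if_neg (by omega), posNeg]
        refine Prod.ext ?_ ?_
        · simp
        · simp only [Int.neg_negSucc]
          omega
    · intro _ i
      rw [if_neg (by simp only [code]; omega), posNeg]
    · exact fun _ _ _ => rfl
    · exact fun _ _ _ => rfl
    · exact fun _ _ => rfl
  exact h.comp (Primrec.const ()) Primrec.id

/-! ### Primitive recursive operations on formulas -/

namespace QF

theorem code_atom_lt (r : Rel) : r.code < 6 := by cases r <;> decide

theorem primrec_atom {α : Type*} [Primcodable α] (r : Rel) {f : α → PolyTerm} (hf : Primrec f) :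
    Primrec fun x => atom r (f x) :=
  Primrec.encode_iff.1 (Primrec.nat_add.comp (Primrec.nat_mul.comp (Primrec.const 3)
    (Primrec.nat_add.comp (Primrec.nat_mul.comp (Primrec.const 6) (Primrec.encode.comp hf))
      (Primrec.const r.code))) (Primrec.const 2))

theorem primrec₂_and : Primrec₂ QF.and :=
  Primrec.encode_iff.1 (Primrec.nat_add.comp (Primrec.nat_mul.comp (Primrec.const 3)
    (Primrec₂.natPair.comp (Primrec.encode.comp Primrec.fst) (Primrec.encode.comp Primrec.snd)))
    (Primrec.const 3))

theorem primrec₂_or : Primrec₂ QF.or :=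
  Primrec.encode_iff.1 (Primrec.nat_add.comp (Primrec.nat_mul.comp (Primrec.const 3)
    (Primrec₂.natPair.comp (Primrec.encode.comp Primrec.fst) (Primrec.encode.comp Primrec.snd)))
    (Primrec.const 4))

/-- Functions defined by structural recursion on formulas are primitive recursive. -/
theorem primrec₂_rec {α σ : Type*} [Primcodable α] [Primcodable σ] {F : α → QF → σ} {t u : σ}
    {l : α → ℕ × PolyTerm → σ} {cj dj : α → σ × σ → σ} (hl : Primrec₂ l) (hcj : Primrec₂ cj)
    (hdj : Primrec₂ dj) (Ht : ∀ a, F a tt = t) (Hf : ∀ a, F a ff = u)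
    (Hl : ∀ a r f, F a (atom r f) = l a (r.code, f))
    (Ha : ∀ a φ χ, F a (and φ χ) = cj a (F a φ, F a χ))
    (Ho : ∀ a φ χ, F a (or φ χ) = dj a (F a φ, F a χ)) : Primrec₂ F := by
  have hlen : Primrec fun p : α × List σ => p.2.length := Primrec.list_length.comp Primrec.snd
  have hsub : Primrec fun p : α × List σ => p.2.length - 2 :=
    Primrec.nat_sub.comp hlen (Primrec.const 2)
  have hmod : Primrec fun p : α × List σ => (p.2.length - 2) % 3 :=
    Primrec.nat_mod.comp hsub (Primrec.const 3)
  have hdiv : Primrec fun p : α × List σ => (p.2.length - 2) / 3 :=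
    Primrec.nat_div.comp hsub (Primrec.const 3)
  have hget {k : α × List σ → ℕ} (hk : Primrec k) : Primrec fun p => p.2[k p]? :=
    Primrec.list_getElem?.comp Primrec.snd hk
  have hun := Primrec.unpair.comp hdiv
  have hbin {b : α → σ × σ → σ} (hb : Primrec₂ b) : Primrec fun p : α × List σ =>
      p.2[((p.2.length - 2) / 3).unpair.1]?.bind fun s =>
        p.2[((p.2.length - 2) / 3).unpair.2]?.map fun t => b p.1 (s, t) :=
    Primrec.option_bind (hget (Primrec.fst.comp hun))
      (Primrec.option_map ((hget (Primrec.snd.comp hun)).comp Primrec.fst)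
        (hb.comp₂ (Primrec.fst.comp (Primrec.fst.comp Primrec.fst))
          ((Primrec.snd.comp Primrec.fst).pair Primrec.snd)))
  have key : Primrec₂ fun a n => F a (Denumerable.ofNat QF n) := by
    -- The codes `0` and `1` are the two truth constants. After subtracting `2`, the residue mod 3
    -- separates atoms, conjunctions and disjunctions; for an atom the quotient holds the relation
    -- as its residue mod 6 and the term as its quotient by 6.
    refine Primrec.nat_strong_rec _
      (g := fun a L => if L.length = 0 then some t else if L.length = 1 then some u
        else if (L.length - 2) % 3 = 0 then
          some (l a ((L.length - 2) / 3 % 6, Denumerable.ofNat PolyTerm ((L.length - 2) / 3 / 6)))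
        else if (L.length - 2) % 3 = 1 then
          L[((L.length - 2) / 3).unpair.1]?.bind fun s =>
            L[((L.length - 2) / 3).unpair.2]?.map fun t => cj a (s, t)
        else
          L[((L.length - 2) / 3).unpair.1]?.bind fun s =>
            L[((L.length - 2) / 3).unpair.2]?.map fun t => dj a (s, t)) ?_ ?_
    · exact Primrec.ite (Primrec.eq.comp hlen (Primrec.const 0)) (Primrec.const (some t))
        (Primrec.ite (Primrec.eq.comp hlen (Primrec.const 1)) (Primrec.const (some u))
          (Primrec.ite (Primrec.eq.comp hmod (Primrec.const 0))
            (Primrec.option_some.comp (hl.comp Primrec.fst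
              ((Primrec.nat_mod.comp hdiv (Primrec.const 6)).pair
                ((Primrec.ofNat PolyTerm).comp (Primrec.nat_div.comp hdiv (Primrec.const 6))))))
            (Primrec.ite (Primrec.eq.comp hmod (Primrec.const 1)) (hbin hcj) (hbin hdj))))
    · intro a n
      obtain ⟨φ, rfl⟩ := code_surjective n
      have hF (φ : QF) : Denumerable.ofNat QF φ.code = φ := Denumerable.ofNat_encode φ
      have hP (f : PolyTerm) : Denumerable.ofNat PolyTerm f.code = f := Denumerable.ofNat_encode f
      have hL (φ : QF) {n : ℕ} (h : φ.code < n) :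
          ((List.range n).map fun m => F a (Denumerable.ofNat QF m))[φ.code]? =
            some (F a φ) := by
        simp [h, hF]
      have hle (φ χ : QF) : φ.code ≤ Nat.pair φ.code χ.code ∧
          χ.code ≤ Nat.pair φ.code χ.code := ⟨Nat.left_le_pair _ _, Nat.right_le_pair _ _⟩
      simp only [List.length_map, List.length_range, hF]
      cases φ with
      | tt => simp [code, Ht]
      | ff => simp [code, Hf]
      | atom r f =>
        have hr := code_atom_lt r
        have h1 : (atom r f).code - 2 = 3 * (6 * f.code + r.code) := by simp only [code]; omega
        have h2 : (6 * f.code + r.code) % 6 = r.code := by omega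
        have h3 : (6 * f.code + r.code) / 6 = f.code := by omega
        rw [if_neg (by simp only [code]; omega), if_neg (by simp only [code]; omega),
          if_pos (by omega), h1, Nat.mul_div_cancel_left _ (by norm_num), h2, h3, hP, Hl]
      | and φ χ =>
        have h1 : ((and φ χ).code - 2) % 3 = 1 := by simp only [code]; omega
        have h2 : ((and φ χ).code - 2) / 3 = Nat.pair φ.code χ.code := by
          simp only [code]; omega
        have := hle φ χ
        rw [if_neg (by omega), if_neg (by omega), if_neg (by omega), if_pos h1, h2,
          Nat.unpair_pair, hL φ (by omega), hL χ (by omega)]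
        simp [Ha]
      | or φ χ =>
        have h1 : ((or φ χ).code - 2) % 3 = 2 := by simp only [code]; omega
        have h2 : ((or φ χ).code - 2) / 3 = Nat.pair φ.code χ.code := by
          simp only [code]; omega
        have := hle φ χ
        rw [if_neg (by omega), if_neg (by omega), if_neg (by omega), if_neg (by omega), h2,
          Nat.unpair_pair, hL φ (by omega), hL χ (by omega)]
        simp [Ho]
  exact (key.comp₂ Primrec₂.left (Primrec.encode.comp₂ Primrec₂.right)).of_eq fun a φ => by simp

theorem primrec_rootAtom (r : Rel) : Primrec (rootAtom r) := by
  open RootExpr PolyTerm in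
  have hs : Primrec fun g : RootExpr => g.a * g.a - g.b * g.b * g.c :=
    primrec₂_sub.comp (primrec₂_mul.comp primrec_a primrec_a)
      (primrec₂_mul.comp (primrec₂_mul.comp primrec_b primrec_b) primrec_c)
  have hab := PolyTerm.primrec₂_mul.comp RootExpr.primrec_a RootExpr.primrec_b
  have had := PolyTerm.primrec₂_mul.comp RootExpr.primrec_a RootExpr.primrec_d
  have hbd := PolyTerm.primrec₂_mul.comp RootExpr.primrec_b RootExpr.primrec_d
  cases r
  · exact primrec₂_and.comp (primrec_atom .eq hs) (primrec_atom .le hab)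
  · exact primrec₂_or.comp (primrec_atom .ne hs) (primrec_atom .gt hab)
  · exact primrec₂_or.comp (primrec₂_and.comp (primrec_atom .le had) (primrec_atom .ge hs))
      (primrec₂_and.comp (primrec_atom .le hbd) (primrec_atom .le hs))
  · exact primrec₂_or.comp (primrec₂_and.comp (primrec_atom .lt had) (primrec_atom .gt hs))
      (primrec₂_and.comp (primrec_atom .le hbd)
        (primrec₂_or.comp (primrec_atom .lt had) (primrec_atom .lt hs)))
  · exact primrec₂_or.comp (primrec₂_and.comp (primrec_atom .ge had) (primrec_atom .ge hs))
      (primrec₂_and.comp (primrec_atom .ge hbd) (primrec_atom .le hs))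
  · exact primrec₂_or.comp (primrec₂_and.comp (primrec_atom .gt had) (primrec_atom .gt hs))
      (primrec₂_and.comp (primrec_atom .ge hbd)
        (primrec₂_or.comp (primrec_atom .gt had) (primrec_atom .lt hs)))

end QF

/-- Case distinction over the relation symbols, given by their codes. -/
def Rel.ofCode {σ : Type*} (s : Rel → σ) (k : ℕ) : σ :=
  if k = 0 then s .eq else if k = 1 then s .ne else if k = 2 then s .le else
    if k = 3 then s .lt else if k = 4 then s .ge else s .gt

theorem Rel.ofCode_code {σ : Type*} (s : Rel → σ) (r : Rel) : Rel.ofCode s r.code = s r := by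
  cases r <;> rfl

theorem Rel.primrec_ofCode {α σ : Type*} [Primcodable α] [Primcodable σ] {s : Rel → α → σ}
    (hs : ∀ r, Primrec (s r)) {k : α → ℕ} (hk : Primrec k) :
    Primrec fun a => Rel.ofCode (fun r => s r a) (k a) := by
  have h (n : ℕ) : PrimrecPred fun a => k a = n := Primrec.eq.comp hk (Primrec.const n)
  exact Primrec.ite (h 0) (hs _) (Primrec.ite (h 1) (hs _) (Primrec.ite (h 2) (hs _)
    (Primrec.ite (h 3) (hs _) (Primrec.ite (h 4) (hs _) (hs _)))))

/-- Only this kind of virtual substitution has to be computed, since the search plugs in standard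
schemes exclusively. -/
theorem QF.primrec₂_vsubst_root :
    Primrec₂ fun (p : ℕ × RootExpr) (φ : QF) => φ.vsubst p.1 (.root p.2) := by
  refine QF.primrec₂_rec (t := tt) (u := ff)
    (l := fun p q => Rel.ofCode (fun r => rootAtom r (q.2.atRoot p.1 p.2)) q.1)
    (cj := fun _ q => and q.1 q.2) (dj := fun _ q => or q.1 q.2) ?_ ?_ ?_
    (fun _ => rfl) (fun _ => rfl) (fun p r f => ?_) (fun _ _ _ => rfl) (fun _ _ _ => rfl)
  · have h : Primrec fun q : (ℕ × RootExpr) × ℕ × PolyTerm => q.2.2.atRoot q.1.1 q.1.2 :=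
      PolyTerm.primrec₂_atRoot.comp Primrec.fst (Primrec.snd.comp Primrec.snd)
    exact Rel.primrec_ofCode (fun r => (primrec_rootAtom r).comp h)
      (Primrec.fst.comp Primrec.snd)
  · exact primrec₂_and.comp (Primrec.fst.comp Primrec.snd) (Primrec.snd.comp Primrec.snd)
  · exact primrec₂_or.comp (Primrec.fst.comp Primrec.snd) (Primrec.snd.comp Primrec.snd)
  · rw [Rel.ofCode_code]
    rfl

/-- The truth value of the constraint `p - q ϱ 0` for natural numbers `p` and `q`. -/
def Rel.test : Rel → ℕ × ℕ → Bool
  | eq, p => decide (p.1 = p.2)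
  | ne, p => !decide (p.1 = p.2)
  | le, p => decide (p.1 ≤ p.2)
  | lt, p => decide (p.1 < p.2)
  | ge, p => decide (p.2 ≤ p.1)
  | gt, p => decide (p.2 < p.1)

theorem Rel.test_iff (r : Rel) (p : ℕ × ℕ) : r.test p ↔ r.Holds ((p.1 : ℝ) - p.2) := by
  cases r <;> simp [test, Holds, sub_eq_zero]

theorem Rel.primrec_test (r : Rel) : Primrec r.test := by
  have hle : Primrec fun p : ℕ × ℕ => decide (p.1 ≤ p.2) := Primrec.nat_le.decide
  have hlt : Primrec fun p : ℕ × ℕ => decide (p.1 < p.2) := Primrec.nat_lt.decide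
  have heq : Primrec fun p : ℕ × ℕ => decide (p.1 = p.2) := Primrec.eq.decide
  have hswap : Primrec fun p : ℕ × ℕ => (p.2, p.1) := Primrec.snd.pair Primrec.fst
  cases r
  exacts [heq, Primrec.not.comp heq, hle, hlt, hle.comp hswap, hlt.comp hswap]

/-- The truth value of a formula where all variables vanish. -/
def QF.test : QF → Bool
  | tt => true
  | ff => false
  | atom r f => r.test f.posNeg
  | and φ χ => φ.test && χ.test
  | or φ χ => φ.test || χ.test

theorem QF.test_iff (φ : QF) : φ.test ↔ φ.Holds 0 := by
  induction φ with
  | tt => simp [test, Holds]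
  | ff => simp [test, Holds]
  | atom r f => rw [test, Rel.test_iff, ← PolyTerm.eval_eq_posNeg, Holds]
  | and φ χ hφ hχ => simp [test, Holds, ← hφ, ← hχ]
  | or φ χ hφ hχ => simp [test, Holds, ← hφ, ← hχ]

theorem QF.primrec_test : Primrec QF.test := by
  have h : Primrec₂ fun (_ : Unit) (φ : QF) => φ.test := by
    refine QF.primrec₂_rec (t := true) (u := false)
      (l := fun _ q => Rel.ofCode (fun r => r.test q.2.posNeg) q.1)
      (cj := fun _ q => q.1 && q.2) (dj := fun _ q => q.1 || q.2) ?_ ?_ ?_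
      (fun _ => rfl) (fun _ => rfl) (fun p r f => ?_) (fun _ _ _ => rfl) (fun _ _ _ => rfl)
    · exact Rel.primrec_ofCode
        (fun r => r.primrec_test.comp (PolyTerm.primrec_posNeg.comp
          (Primrec.snd.comp Primrec.snd))) (Primrec.fst.comp Primrec.snd)
    · exact Primrec.and.comp (Primrec.fst.comp Primrec.snd) (Primrec.snd.comp Primrec.snd)
    · exact Primrec.or.comp (Primrec.fst.comp Primrec.snd) (Primrec.snd.comp Primrec.snd)
    · rw [Rel.ofCode_code]
      rfl
  exact h.comp (Primrec.const ()) Primrec.id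

/-! ### Computing replacements and plugged formulas -/

theorem ElimTerm.primrec₂_toRoot :
    Primrec₂ fun (p : ℕ × ℕ) (e : ElimTerm) => e.toRoot p.1 p.2 := by
  have hsum : Primrec equivSum := Primrec.encode_iff.1 Primrec.encode
  have hi : Primrec fun q : (ℕ × ℕ) × ElimTerm => (⟨.const q.1.2, 0, 0, 1⟩ : RootExpr) :=
    RootExpr.primrec_mk (PolyTerm.primrec_const_natCast.comp (Primrec.snd.comp Primrec.fst))
      (Primrec.const 0) (Primrec.const 0) (Primrec.const 1)
  have hm : Primrec fun q : (ℕ × ℕ) × ElimTerm => PolyTerm.const (q.1.2 + 1 : ℕ) :=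
    PolyTerm.primrec_const_natCast.comp (Primrec.succ.comp (Primrec.snd.comp Primrec.fst))
  have hn : Primrec fun q : (ℕ × ℕ) × ElimTerm =>
      (⟨.const (q.1.2 + 1 : ℕ) * .var (q.1.1 + 1) - 1, 0, 0, .const (q.1.2 + 1 : ℕ)⟩ :
        RootExpr) :=
    RootExpr.primrec_mk
      (PolyTerm.primrec₂_sub.comp
        (PolyTerm.primrec₂_mul.comp hm
          (PolyTerm.primrec_var.comp (Primrec.succ.comp (Primrec.fst.comp Primrec.fst))))
        (Primrec.const 1))
      (Primrec.const 0) (Primrec.const 0) hm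
  refine (Primrec.option_casesOn (hsum.comp Primrec.snd) hi
    (Primrec.option_casesOn Primrec.snd (hn.comp Primrec.fst) Primrec.snd.to₂).to₂).of_eq ?_
  rintro ⟨p, e⟩
  cases e <;> rfl

/-- Rewrites the recursion as a left fold whose state holds the index, the unused parameters and the
output so far, so that primitive recursiveness of folds applies. -/
theorem Scheme.foldl_toStd (S : Scheme) (i : ℕ) (L : List ℕ) (T : StdScheme) :
    (S.foldl (fun (s : ℕ × List ℕ × StdScheme) p => (s.1 + 1, s.2.1.tail,
      s.2.2 ++ [(p.1.toRoot s.1 (s.2.1.getD 0 0), p.2)])) (i, L, T)).2.2 = T ++ toStd i S L := by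
  induction S generalizing i L T with
  | nil => simp [toStd]
  | cons p S ih =>
    rw [List.foldl_cons, ih, toStd, List.append_assoc, List.singleton_append]

theorem Scheme.primrec₂_toStd : Primrec₂ fun (S : Scheme) (L : List ℕ) => toStd 0 S L := by
  refine (Primrec.snd.comp (Primrec.snd.comp (Primrec.list_foldl
    (f := fun q : Scheme × List ℕ => q.1) (g := fun q => ((0, q.2, []) : ℕ × List ℕ × StdScheme))
    (h := fun _ s => (s.1.1 + 1, s.1.2.1.tail,
      s.1.2.2 ++ [(s.2.1.toRoot s.1.1 (s.1.2.1.getD 0 0), s.2.2)]))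
    Primrec.fst ((Primrec.const 0).pair (Primrec.snd.pair (Primrec.const []))) ?_))).of_eq
      fun q => (foldl_toStd q.1 0 q.2 []).trans (List.nil_append _)
  have hs : Primrec fun q : (Scheme × List ℕ) × (ℕ × List ℕ × StdScheme) × ElimTerm × QF =>
      q.2.1 := Primrec.fst.comp Primrec.snd
  have hp : Primrec fun q : (Scheme × List ℕ) × (ℕ × List ℕ × StdScheme) × ElimTerm × QF =>
      q.2.2 := Primrec.snd.comp Primrec.snd
  have hL := Primrec.fst.comp (Primrec.snd.comp hs)
  exact (Primrec.succ.comp (Primrec.fst.comp hs)).pair ((Primrec.list_tail.comp hL).pair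
    (Primrec.list_append.comp (Primrec.snd.comp (Primrec.snd.comp hs))
      (Primrec.list_cons.comp
        ((ElimTerm.primrec₂_toRoot.comp
          ((Primrec.fst.comp hs).pair ((Primrec.list_getD 0).comp hL (Primrec.const 0)))
          (Primrec.fst.comp hp)).pair (Primrec.snd.comp hp)) (Primrec.const []))))

theorem Scheme.foldl_plugFrom (T : StdScheme) (i : ℕ) (ψ : QF) :
    (T.foldl (fun (s : ℕ × QF) p => (s.1 + 1, QF.and p.2 (s.2.vsubst s.1 (.root p.1))))
      (i, ψ)).2 = plugFrom i ψ T.toScheme := by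
  induction T generalizing i ψ with
  | nil => rfl
  | cons p T ih => exact ih _ _

theorem Scheme.primrec₂_plugFrom :
    Primrec₂ fun (ψ : QF) (T : StdScheme) => plugFrom 0 ψ T.toScheme := by
  refine (Primrec.snd.comp (Primrec.list_foldl
    (f := fun q : QF × StdScheme => q.2) (g := fun q => ((0, q.1) : ℕ × QF))
    (h := fun _ s => (s.1.1 + 1, QF.and s.2.2 (s.1.2.vsubst s.1.1 (.root s.2.1))))
    Primrec.snd ((Primrec.const 0).pair Primrec.fst) ?_)).of_eq
      fun q => foldl_plugFrom q.2 0 q.1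
  have hs : Primrec fun q : (QF × StdScheme) × (ℕ × QF) × RootExpr × QF => q.2.1 :=
    Primrec.fst.comp Primrec.snd
  have hp : Primrec fun q : (QF × StdScheme) × (ℕ × QF) × RootExpr × QF => q.2.2 :=
    Primrec.snd.comp Primrec.snd
  exact (Primrec.succ.comp (Primrec.fst.comp hs)).pair
    (QF.primrec₂_and.comp (Primrec.snd.comp hp)
      (QF.primrec₂_vsubst_root.comp ((Primrec.fst.comp hs).pair (Primrec.fst.comp hp))
        (Primrec.snd.comp hs)))

/-! ### The search for a standard scheme -/

/-- The candidate with number `k` for a standard scheme that replaces `S`. -/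
def Scheme.candidate (S : Scheme) (k : ℕ) : StdScheme :=
  Scheme.toStd 0 S (Denumerable.ofNat (List ℕ) k)

/-- The search for the first candidate that makes the plugged formula true. -/
def standardAnswers (p : QF × Scheme) : Part StdScheme :=
  (Nat.rfind fun k =>
    Part.some (QF.test (Scheme.plugFrom 0 p.1 (p.2.candidate k).toScheme))).map p.2.candidate

theorem partrec_standardAnswers : Partrec standardAnswers := by
  have hc : Primrec₂ fun (p : QF × Scheme) (k : ℕ) => p.2.candidate k :=
    Scheme.primrec₂_toStd.comp (Primrec.snd.comp Primrec.fst)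
      ((Primrec.ofNat (List ℕ)).comp Primrec.snd)
  have ht : Primrec₂ fun (p : QF × Scheme) (k : ℕ) =>
      QF.test (Scheme.plugFrom 0 p.1 (p.2.candidate k).toScheme) :=
    QF.primrec_test.comp (Scheme.primrec₂_plugFrom.comp (Primrec.fst.comp Primrec.fst) hc)
  exact (Partrec.rfind ht.to_comp.partrec₂).map hc.to_comp

/-- Termination and correctness are separate: the parameters obtained by analysis show that some
candidate passes, while the one found first may be different and is justified by the test alone. -/
theorem IsPreEQR.exists_mem_standardAnswers {n : ℕ} {ψ : QF} {S : Scheme}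
    (h : IsPreEQR n ψ S) : ∃ T ∈ standardAnswers (ψ, S), IsPreEQR n ψ T.toScheme := by
  obtain ⟨L, v, hL⟩ := h.exists_holds_plugFrom
  have hdom : (Nat.rfind fun k =>
      Part.some (QF.test (Scheme.plugFrom 0 ψ (S.candidate k).toScheme))).Dom := by
    -- The code of `L` bounds the search; each single test is total, so no earlier candidate can
    -- block it.
    refine Nat.rfind_dom.2 ⟨Encodable.encode L, ?_, fun _ => trivial⟩
    rw [Part.mem_some_iff]
    refine ((QF.test_iff _).2 ?_).symm
    rw [Scheme.candidate, Denumerable.ofNat_encode]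
    exact (isPreEQR_toStd h hL).2.2.2 0
  obtain ⟨k, hk⟩ := Part.dom_iff_mem.1 hdom
  refine ⟨S.candidate k, Part.mem_map_iff _ |>.2 ⟨k, hk, rfl⟩, ?_⟩
  -- The test certifies truth at the zero valuation, which suffices because the plugged formula does
  -- not depend on the valuation.
  exact isPreEQR_toStd h ((QF.test_iff _).1 (Part.mem_some_iff.1 (Nat.rfind_spec hk)).symm)

end VirtSubst

theorem mainTheorem1 :
    ∃ F : VirtSubst.QF × VirtSubst.Scheme →. VirtSubst.StdScheme, Partrec F ∧
      ∀ (n : ℕ) (ψ : VirtSubst.QF) (S : VirtSubst.Scheme), VirtSubst.IsPreEQR n ψ S →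
        ∃ T ∈ F (ψ, S), VirtSubst.IsPreEQR n ψ T.toScheme ∧
          ∃ α : ℕ → ℝ, T.IsBackSubst α ∧ ψ.Holds α := by
  refine ⟨VirtSubst.standardAnswers, VirtSubst.partrec_standardAnswers, fun n ψ S h => ?_⟩
  obtain ⟨T, hT, hpre⟩ := h.exists_mem_standardAnswers
  exact ⟨T, hT, hpre, hpre.exists_isBackSubst⟩
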